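/- Let $\mathbb I=[0,1]$, let $m$ be two-dimensional Lebesgue measure on $\mathbb I\times\mathbb I$, and for $a,b\in(0,1/2)$ let $$F_{a,b}:\mathbb I\times\mathbb I\to\mathbb I\times\mathbb I,\qquad F_{a,b}(x,y)=(f(x),g_{a,b,x}(y)),$$ where $f(x)=2x$ for $0\le x<1/2$ and $f(x)=2x-1$ for $1/2\le x\le1$ (so $f(1)=1$), and where $g_{a,b,x}(y)=y+ay(1-y)$ for $0\le x<1/2$ and $g_{a,b,x}(y)=y-by(1-y)$ for $1/2\le x\le 1$. Put $A_0=\mathbb I\times\{0\}$, $A_1=\mathbb I\times\{1\}$ and $$\Gamma_0=\{(a,b)\in(0,\tfrac12)^2: b>\tfrac{a}{1+a}\},\quad \Gamma_1=\{(a,b)\in(0,\tfrac12)^2: b<\tfrac{a}{1-a}\},\quad \Gamma=\Gamma_0\cap\Gamma_1.$$ Definitions, for a map $F$ of $\mathbb I\times\mathbb I$ to itself (not necessarily continuous). The basin $\mathcal B(A)$ is the set of points $p$ whose $\omega$-limit set $\omega(p)$ is contained in $A$. A compact set $A$ with $F(A)=A$ is * a *Milnor attractor* if $m(\mathcal B(A))>0$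 and no compact proper subset $A'\subsetneq A$ has a basin that coincides with $\mathcal B(A)$ up to a set of $m$-measure zero; * an *essential attractor* if it is a Milnor attractor and $\lim_{\delta\to0^+} m(B_\delta(A)\cap\mathcal B(A))/m(B_\delta(A))=1$, where $B_\delta(A)$ is the $\delta$-neighbourhood of $A$; * a *chaotic attractor* if it is a Milnor attractor, is transitive ($\omega(p)=A$ for some $p\in A$), and is the support of an ergodic $F$-invariant probability measure $\mu$ which is not the only ergodic invariant probability measure on $A$ and for which some Lyapunov exponent is positive, that is, there is $\lambda>0$ such that for $\mu$-almost every $p$ there is a vector $v$ with $\lim_{n}\frac1n\log\|dF^n(p)v\|=\lambda$. A Milnor attractor $A$ has a *locally riddled basin* if there is a neighbourhood $U$ of $A$ such that $m\bigl(B_\varepsilon(p)\cap(\bigcap_{n\ge0}F^{-n}(U))^c\bigr)>0$ for all $p\in A$ and $\varepsilon>0$. The basins of two distinct Milnor attractors $A,A'$ are *intermingled* if $m(B_\varepsilon(p)\cap\mathcal B(A))>0$ and $m(B_\varepsilon(p)\cap\mathcal B(A'))>0$ for all $p\in\mathbb I\times\mathbb I$ and $\varepsilon>0$. **Theorem.**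 Let $a,b\in(0,1/2)$. 1. If $(a,b)\in\Gamma_0$, then $A_0$ is a chaotic and essential Milnor attractor of $F_{a,b}$ with a locally riddled basin. 2. If $(a,b)\in\Gamma_1$, then $A_1$ is a chaotic and essential Milnor attractor of $F_{a,b}$ with a locally riddled basin. 3. If $(a,b)\in\Gamma$, then $A_0$ and $A_1$ are both chaotic and essential Milnor attractors of $F_{a,b}$ and their basins are intermingled. Moreover there is a measurable function $\varphi^*:\mathbb I\to\mathbb I$ whose graph is invariant, i.e. $g_{a,b,x}(\varphi^*(x))=\varphi^*(f(x))$ for all $x\in\mathbb I$, and which separates the basins: for Lebesgue-almost every $x\in\mathbb I$ and all $y\in\mathbb I$, $(x,y)\in\mathcal B(A_0)$ if $y<\varphi^*(x)$, and $(x,y)\in\mathcal B(A_1)$ if $y>\varphi^*(x)$. -/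

import Mathlib

open MeasureTheory Filter Topology

namespace SkewProduct

/-! ### Attractors and basins for a self-map of a metric measure space -/

section Attractors

variable {M : Type*} [MetricSpace M] [MeasurableSpace M]

/-- The omega-limit set of the orbit `x, F x, F (F x), …`: all its accumulation points. -/
def omegaSet (F : M → M) (x : M) : Set M :=
  omegaLimit atTop (fun n : ℕ => F^[n]) {x}

/-- The basin of attraction of `A`: the points whose omega-limit set is contained in `A`. -/
def basin (F : M → M) (A : Set M) : Set M :=
  {x | omegaSet F x ⊆ A}

/-- `A` is a Milnor attractor of `F` with respect to the reference measure `m`: it is compact,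
`F(A) = A`, its basin has nonzero measure, and no compact proper subset of `A` has the same basin
up to a set of measure zero. -/
structure IsMilnorAttractor (m : Measure M) (F : M → M) (A : Set M) : Prop where
  isCompact : IsCompact A
  invariant : F '' A = A
  basin_pos : 0 < m (basin F A)
  minimal : ∀ A' : Set M, IsCompact A' → A' ⊂ A → ¬ (basin F A' =ᵐ[m] basin F A)

/-- An essential attractor: a Milnor attractor `A` such that the proportion of the
`δ`-neighbourhood of `A` that lies in the basin of `A` tends to `1` as `δ → 0`. -/
structure IsEssentialAttractor (m : Measure M) (F : M → M) (A : Set M) : Prop where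
  milnor : IsMilnorAttractor m F A
  density : Tendsto
    (fun δ : ℝ => m (Metric.thickening δ A ∩ basin F A) / m (Metric.thickening δ A))
    (𝓝[>] 0) (𝓝 1)

/-- `A` is transitive: some orbit starting in `A` has omega-limit set equal to `A`
(in particular that orbit is dense in `A`). -/
def IsTransitive (F : M → M) (A : Set M) : Prop :=
  ∃ x ∈ A, omegaSet F x = A

/-- The Milnor attractor `A` has a locally riddled basin: for some neighbourhood `U` of `A`, every
ball around every point of `A` contains a set of positive measure of points whose orbit does not
stay in `U`. -/
structure HasLocallyRiddledBasin (m : Measure M) (F : M → M) (A : Set M) : Prop where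
  milnor : IsMilnorAttractor m F A
  riddled : ∃ U ∈ 𝓝ˢ A, ∀ x ∈ A, ∀ ε : ℝ, 0 < ε →
    0 < m (Metric.ball x ε ∩ (⋂ n : ℕ, F^[n] ⁻¹' U)ᶜ)

/-- The basin of the Milnor attractor `A` is riddled with the basin of another Milnor attractor
`A'`: every ball of the phase space meets the basin of `A'` in a set of positive measure. -/
structure IsRiddledWith (m : Measure M) (F : M → M) (A A' : Set M) : Prop where
  milnor : IsMilnorAttractor m F A
  milnor' : IsMilnorAttractor m F A'
  ne : A ≠ A'
  riddled : ∀ x : M, ∀ ε : ℝ, 0 < ε → 0 < m (Metric.ball x ε ∩ basin F A')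

/-- The basins of `A` and `A'` are intermingled: each is riddled with the other. -/
def AreIntermingled (m : Measure M) (F : M → M) (A A' : Set M) : Prop :=
  IsRiddledWith m F A A' ∧ IsRiddledWith m F A' A

end Attractors

/-! ### Lyapunov exponents and chaotic attractors on the unit square -/

/-- The phase space `[0,1] × [0,1]`; its volume is two-dimensional Lebesgue measure. -/
abbrev Square : Type := unitInterval × unitInterval

/-- The inclusion of the unit square in the plane. -/
def toPlane (p : Square) : ℝ × ℝ := ((p.1 : ℝ), (p.2 : ℝ))

/-- A map of the square as a map of the plane; its values outside the square are never used. -/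
noncomputable def planeMap (G : Square → Square) (q : ℝ × ℝ) : ℝ × ℝ :=
  toPlane (G (Set.projIcc 0 1 zero_le_one q.1, Set.projIcc 0 1 zero_le_one q.2))

/-- The total derivative at `p` of a map of the square (one-sided at boundary points). -/
noncomputable def totalDeriv (G : Square → Square) (p : Square) : (ℝ × ℝ) →L[ℝ] (ℝ × ℝ) :=
  fderivWithin ℝ (planeMap G) (Set.Icc 0 1 ×ˢ Set.Icc 0 1) (toPlane p)

/-- `l` is the Lyapunov exponent of `F` at `p` in the direction `v`:
`l = lim (1/n) log ‖dFⁿ(p) v‖`. -/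
def IsLyapunovExponent (F : Square → Square) (p : Square) (v : ℝ × ℝ) (l : ℝ) : Prop :=
  Tendsto (fun n : ℕ => (1 / (n : ℝ)) * Real.log ‖totalDeriv (F^[n]) p v‖) atTop (𝓝 l)

/-- Some Lyapunov exponent of `F` with respect to `μ` is positive. A positive limit forces the
derivatives of the iterates at `p` to exist and not to vanish on `v` from some `n` on. -/
def HasPositiveLyapunovExponent (F : Square → Square) (μ : Measure Square) : Prop :=
  ∃ l : ℝ, 0 < l ∧ ∀ᵐ p ∂μ, ∃ v : ℝ × ℝ, IsLyapunovExponent F p v l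

/-- A chaotic attractor: a transitive Milnor attractor `A` (with respect to Lebesgue measure)
that is the support of an ergodic invariant probability measure `μ` which is not the only ergodic
measure on `A`, and for which some Lyapunov exponent is positive. -/
structure IsChaoticAttractor (F : Square → Square) (A : Set Square) : Prop where
  milnor : IsMilnorAttractor volume F A
  transitive : IsTransitive F A
  exists_ergodic : ∃ μ : Measure Square, IsProbabilityMeasure μ ∧ Ergodic F μ ∧
    μ.support = A ∧ HasPositiveLyapunovExponent F μ ∧
    ∃ ν : Measure Square, IsProbabilityMeasure ν ∧ Ergodic F ν ∧ ν Aᶜ = 0 ∧ ν ≠ μ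

/-! ### The two-parameter family -/

/-- The range `(0, 1/2)` of each parameter. -/
abbrev Param : Type := Set.Ioo (0 : ℝ) (1 / 2)

theorem doubling_mem_left {x : unitInterval} (h : (x : ℝ) < 1 / 2) :
    2 * (x : ℝ) ∈ unitInterval :=
  ⟨by linarith [x.2.1], by linarith⟩

theorem doubling_mem_right {x : unitInterval} (h : ¬ (x : ℝ) < 1 / 2) :
    2 * (x : ℝ) - 1 ∈ unitInterval :=
  ⟨by linarith [not_lt.mp h], by linarith [x.2.2]⟩

/-- The doubling map `x ↦ 2x mod 1` of `[0,1]`, with two full branches; the end point `1` is a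
fixed point. -/
noncomputable def doubling (x : unitInterval) : unitInterval :=
  if h : (x : ℝ) < 1 / 2 then ⟨2 * x, doubling_mem_left h⟩ else ⟨2 * x - 1, doubling_mem_right h⟩

theorem fiberUp_mem (a : Param) (y : unitInterval) :
    (y : ℝ) + a * y * (1 - y) ∈ unitInterval := by
  obtain ⟨a, ha0, ha1⟩ := a
  obtain ⟨y, hy0, hy1⟩ := y
  have h1 : 0 ≤ y * (1 - y) := mul_nonneg hy0 (by linarith)
  constructor
  · nlinarith [mul_nonneg ha0.le h1]
  · nlinarith [mul_nonneg (sub_nonneg.2 hy1) (show 0 ≤ 1 - a * y by nlinarith)]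

theorem fiberDown_mem (b : Param) (y : unitInterval) :
    (y : ℝ) - b * y * (1 - y) ∈ unitInterval := by
  obtain ⟨b, hb0, hb1⟩ := b
  obtain ⟨y, hy0, hy1⟩ := y
  have h1 : 0 ≤ y * (1 - y) := mul_nonneg hy0 (by linarith)
  constructor
  · nlinarith [mul_nonneg hy0 (show 0 ≤ 1 - b * (1 - y) by nlinarith)]
  · nlinarith [mul_nonneg hb0.le h1]

/-- `g_a(y) = y + a y (1 - y)`. -/
def fiberUp (a : Param) (y : unitInterval) : unitInterval :=
  ⟨y + a * y * (1 - y), fiberUp_mem a y⟩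

/-- `g_b(y) = y - b y (1 - y)`. -/
def fiberDown (b : Param) (y : unitInterval) : unitInterval :=
  ⟨y - b * y * (1 - y), fiberDown_mem b y⟩

/-- The fibre map over `x`: `g_a` if `0 ≤ x < 1/2` and `g_b` if `1/2 ≤ x ≤ 1`. -/
noncomputable def fiberMap (a b : Param) (x y : unitInterval) : unitInterval :=
  if (x : ℝ) < 1 / 2 then fiberUp a y else fiberDown b y

/-- The skew product `F_{a,b}(x, y) = (f(x), g_{a,b}(x, y))`. -/
noncomputable def skewMap (a b : Param) (p : Square) : Square :=
  (doubling p.1, fiberMap a b p.1 p.2)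

/-- The invariant segment `[0,1] × {i}`, for `i = 0, 1`. -/
def invSegment (i : unitInterval) : Set Square := {p | p.2 = i}

/-- The parameter region `b > a / (1 + a)`. -/
def Gamma0 : Set (Param × Param) := {q | (q.2 : ℝ) > q.1 / (1 + q.1)}

/-- The parameter region `b < a / (1 - a)`. -/
def Gamma1 : Set (Param × Param) := {q | (q.2 : ℝ) < q.1 / (1 - q.1)}

/-- The common region of the parameters. -/
def Gamma : Set (Param × Param) := Gamma0 ∩ Gamma1

/-- A measurable invariant graph of `F_{a,b}`: `g_{a,b,x}(φ(x)) = φ(f(x))` for all `x`. -/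
structure IsInvariantGraph (a b : Param) (φ : unitInterval → unitInterval) : Prop where
  measurable : Measurable φ
  invariant : ∀ x, fiberMap a b x (φ x) = φ (doubling x)

/-- The graph of `φ` separates the basins of `A₀` and `A₁`: over almost every `x`, all points
below the graph are in the basin of `A₀` and all points above it are in the basin of `A₁`. -/
def SeparatesBasins (F : Square → Square) (A₀ A₁ : Set Square)
    (φ : unitInterval → unitInterval) : Prop :=
  ∀ᵐ x : unitInterval, ∀ y : unitInterval,
    (y < φ x → (x, y) ∈ basin F A₀) ∧ (φ x < y → (x, y) ∈ basin F A₁)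

end SkewProduct

open SkewProduct

/-!
Everything is a statement about the doubling map `f` with Lebesgue measure and about random
compositions of the two fibre maps, the choice being made by the binary digits of the base point.

*Attraction.* Let `z` be the distance to an end point `i` of the fibre. Both fibre maps have the
form `z ↦ z (1 + c (1 - z))`, and the parameter conditions say exactly that the product of the two
multipliers `1 + c` is less than `1`, that is, that the normal Lyapunov exponent of `[0,1] × {i}`
is negative. For a small power `t > 0`, the `t`-th moment of the product of the multipliers along
an orbit is `θ ^ n` with `θ < 1`, because the first digit of `x` is independent of `f x`
(`lintegral_ite_mul_doubling`). So these moments are summable and the products tend to zero almost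
surely (`ae_tendsto_orbitProd`); no ergodic theorem is needed. Hence almost every fibre
contains a neighbourhood of `i` in the basin (`fiberStable_of_mul_lt_one`), and continuity of
measure gives density `1` of the basin near the segment (`tendsto_density`).

*Minimality and chaos.* The doubling map is a factor of multiplication by `2` on the circle, hence
ergodic, and almost all its orbits visit every open set infinitely often. So the omega-limit set of
almost every point of the basin is the whole segment, which makes the segment a Milnor attractor.
Lebesgue measure on the segment is ergodic, and so is the Dirac measure at the fixed point over
`0`. Off the preimages of the discontinuity, iterates are locally products of an affine map of
slope `2 ^ n` and a smooth map, so the horizontal Lyapunov exponent is `log 2`.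

*Riddling.* Every ball contains a dyadic column that an iterate of the skew product spreads over
the whole base; continuing with a long run of equal digits brings it as close as desired to either
segment (`exists_time_forall_volume_pos`). This yields locally riddled and intermingled basins.

*Separation.* The supremum of the points of a fibre attracted to `0` and the infimum of those
attracted to `1` are invariant graphs. The fibre maps strictly decrease the cross-ratio of
`0 < p < q < 1` (`crossRatio_quadratic_lt`), whereas a bounded function cannot decrease along a
measure-preserving map on a set of positive measure. So the two graphs agree almost everywhere
(`ae_lowerGraph_eq_upperGraph`).
-/

namespace SkewProduct

open scoped ENNReal

/-! ### The doubling map -/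

/-- The offset `0` or `1` of the left (`false`) or right (`true`) branch of the doubling map. -/
def digit (d : Bool) : ℝ := if d then 1 else 0

/-- The inverse branches `t ↦ t / 2` and `t ↦ (t + 1) / 2` of the doubling map. -/
noncomputable def branch (d : Bool) (t : unitInterval) : unitInterval :=
  ⟨(t + digit d) / 2, by
    have h0 := t.2.1
    have h1 := t.2.2
    cases d <;> simp only [digit] <;> constructor <;> norm_num <;> linarith⟩

theorem coe_branch (d : Bool) (t : unitInterval) : (branch d t : ℝ) = (t + digit d) / 2 := rfl

theorem coe_doubling_of_lt {x : unitInterval} (h : (x : ℝ) < 1 / 2) :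
    (doubling x : ℝ) = 2 * x := by
  simp only [doubling, dif_pos h]

theorem coe_doubling_of_not_lt {x : unitInterval} (h : ¬ (x : ℝ) < 1 / 2) :
    (doubling x : ℝ) = 2 * x - 1 := by
  simp only [doubling, dif_neg h]

theorem continuous_branch (d : Bool) : Continuous (branch d) := by
  unfold branch
  fun_prop

theorem coe_lt_one {t : unitInterval} (ht : t ≠ 1) : (t : ℝ) < 1 :=
  lt_of_le_of_ne t.2.2 fun h => ht (Subtype.ext h)

theorem branch_lt_half_iff {t : unitInterval} (ht : t ≠ 1) (d : Bool) :
    (branch d t : ℝ) < 1 / 2 ↔ d = false := by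
  have h1 := coe_lt_one ht
  have h0 := t.2.1
  cases d <;> simp [coe_branch, digit] <;> linarith

theorem branch_ne_one {t : unitInterval} (ht : t ≠ 1) (d : Bool) : branch d t ≠ 1 := by
  have h1 := coe_lt_one ht
  intro h
  have h2 : (branch d t : ℝ) = 1 := by rw [h]; rfl
  rw [coe_branch] at h2
  cases d <;> simp only [digit] at h2 <;> norm_num at h2 <;> linarith

/-- The end point `t = 1` is excluded because the left branch sends it to `1/2`, which belongs to
the right half of the interval. -/
theorem doubling_branch {t : unitInterval} (ht : t ≠ 1) (d : Bool) :
    doubling (branch d t) = t := by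
  apply Subtype.ext
  have h := branch_lt_half_iff ht d
  cases d
  · rw [coe_doubling_of_lt (h.2 rfl), coe_branch]
    simp only [digit, Bool.false_eq_true, if_false]
    ring
  · rw [coe_doubling_of_not_lt (by rw [h]; simp), coe_branch]
    simp only [digit, if_true]
    ring

theorem measurable_doubling : Measurable doubling := by
  rw [← unitInterval.measurableEmbedding_coe.measurable_comp_iff]
  have e : ((↑) : unitInterval → ℝ) ∘ doubling =
      fun x : unitInterval => if (x : ℝ) < 1 / 2 then 2 * (x : ℝ) else 2 * x - 1 := by
    ext x
    simp only [Function.comp_apply]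
    split_ifs with h
    · exact coe_doubling_of_lt h
    · exact coe_doubling_of_not_lt h
  rw [e]
  exact Measurable.ite (measurableSet_lt measurable_subtype_coe measurable_const)
    (by fun_prop) (by fun_prop)

/-- Lebesgue measure on `[0,1]` is the average of its images under the two inverse branches. -/
theorem volume_eq_sum_map_branch :
    (volume : Measure unitInterval) =
      (2⁻¹ : ℝ≥0∞) • ((volume.map (branch false)) + (volume.map (branch true))) := by
  have : IsFiniteMeasure ((2⁻¹ : ℝ≥0∞) •
      ((volume.map (branch false)) + (volume.map (branch true)))) := by
    apply Measure.smul_finite; simp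
  refine Measure.ext_of_Iic _ _ fun x => ?_
  have h0 := x.2.1
  have h1 := x.2.2
  rw [Measure.smul_apply, Measure.add_apply,
    Measure.map_apply (continuous_branch _).measurable measurableSet_Iic,
    Measure.map_apply (continuous_branch _).measurable measurableSet_Iic,
    unitInterval.volume_Iic, smul_eq_mul]
  by_cases hx : (x : ℝ) < 1 / 2
  · have e1 : branch false ⁻¹' Set.Iic x = Set.Iic ⟨2 * x, by constructor <;> linarith⟩ := by
      ext t
      simp only [Set.mem_preimage, Set.mem_Iic, ← Subtype.coe_le_coe, coe_branch, digit]
      norm_num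
      constructor <;> intro <;> linarith
    have e2 : branch true ⁻¹' Set.Iic x = ∅ := by
      ext t
      have := t.2.1
      simp only [Set.mem_preimage, Set.mem_Iic, ← Subtype.coe_le_coe, coe_branch, digit]
      norm_num
      linarith
    rw [e1, e2, unitInterval.volume_Iic, measure_empty, add_zero, ENNReal.ofReal_mul (by norm_num),
      ← mul_assoc]
    simp [ENNReal.inv_mul_cancel]
  · have e1 : branch false ⁻¹' Set.Iic x = Set.univ := by
      ext t
      have := t.2.2
      simp only [Set.mem_preimage, Set.mem_Iic, ← Subtype.coe_le_coe, coe_branch, digit]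
      norm_num
      linarith
    have e2 : branch true ⁻¹' Set.Iic x = Set.Iic ⟨2 * x - 1, by constructor <;> linarith⟩ := by
      ext t
      simp only [Set.mem_preimage, Set.mem_Iic, ← Subtype.coe_le_coe, coe_branch, digit]
      norm_num
      constructor <;> intro <;> linarith
    rw [e1, e2, unitInterval.volume_Iic, measure_univ, ← ENNReal.ofReal_one,
      ← ENNReal.ofReal_add (by norm_num) (by simp; linarith)]
    have : (2⁻¹ : ℝ≥0∞) = ENNReal.ofReal 2⁻¹ := by
      rw [ENNReal.ofReal_inv_of_pos (by norm_num)]; simp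
    rw [this, ← ENNReal.ofReal_mul (by norm_num)]
    congr 1
    ring

theorem lintegral_eq_branch {h : unitInterval → ℝ≥0∞} (hh : Measurable h) :
    ∫⁻ x, h x = 2⁻¹ * ((∫⁻ t, h (branch false t)) + ∫⁻ t, h (branch true t)) := by
  conv_lhs => rw [volume_eq_sum_map_branch]
  rw [lintegral_smul_measure, lintegral_add_measure,
    lintegral_map hh (continuous_branch _).measurable,
    lintegral_map hh (continuous_branch _).measurable, smul_eq_mul]

theorem ae_ne (c : unitInterval) : ∀ᵐ t : unitInterval, t ≠ c := by
  rw [ae_iff]; simp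

/-- A function of the first binary digit and a function of the remaining ones are independent. -/
theorem lintegral_ite_mul_doubling (r s : ℝ≥0∞) {h : unitInterval → ℝ≥0∞} (hh : Measurable h) :
    ∫⁻ x : unitInterval, (if (x : ℝ) < 1 / 2 then r else s) * h (doubling x) =
      2⁻¹ * (r + s) * ∫⁻ t, h t := by
  have hm : Measurable fun x : unitInterval =>
      (if (x : ℝ) < 1 / 2 then r else s) * h (doubling x) :=
    (Measurable.ite (measurableSet_lt measurable_subtype_coe measurable_const) measurable_const
      measurable_const).mul (hh.comp measurable_doubling)
  rw [lintegral_eq_branch hm]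
  have e : ∀ d : Bool,
      ∫⁻ t, (if (branch d t : ℝ) < 1 / 2 then r else s) * h (doubling (branch d t)) =
      (if d = false then r else s) * ∫⁻ t, h t := by
    intro d
    rw [← lintegral_const_mul _ hh]
    refine lintegral_congr_ae ?_
    filter_upwards [ae_ne 1] with t ht
    rw [doubling_branch ht]
    simp only [branch_lt_half_iff ht]
  rw [e, e]
  simp only [if_true, Bool.true_eq_false, if_false]
  ring

theorem measurePreserving_doubling : MeasurePreserving doubling := by
  refine ⟨measurable_doubling, ?_⟩
  refine Measure.ext_of_lintegral _ fun h hh => ?_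
  rw [lintegral_map hh measurable_doubling]
  have := lintegral_ite_mul_doubling 1 1 hh
  simpa [one_add_one_eq_two, ENNReal.inv_mul_cancel] using this

instance : (volume : Measure unitInterval).IsOpenPosMeasure where
  open_pos U hU hne := by
    obtain ⟨x, y, hxy, h⟩ := hU.exists_Ioo_subset hne
    have h1 : 0 < volume (Set.Ioo x y) := by
      rw [unitInterval.volume_Ioo, ENNReal.ofReal_pos]
      exact sub_pos.2 hxy
    exact (h1.trans_le (measure_mono h)).ne'

/-- The representative in `[0,1)` of a point of the circle `ℝ / ℤ`. -/
noncomputable def circleRep (z : AddCircle (1 : ℝ)) : unitInterval :=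
  ⟨AddCircle.equivIco 1 0 z, by
    have := (AddCircle.equivIco 1 0 z).2
    simp only [Set.mem_Ico] at this
    constructor <;> linarith⟩

theorem coe_circleRep (z : AddCircle (1 : ℝ)) : ((circleRep z : ℝ) : AddCircle (1 : ℝ)) = z :=
  AddCircle.coe_equivIco

theorem circleRep_lt_one (z : AddCircle (1 : ℝ)) : (circleRep z : ℝ) < 1 := by
  have := (AddCircle.equivIco 1 0 z).2.2
  exact this.trans_eq (zero_add 1)

theorem circleRep_coe {x : ℝ} (h0 : 0 ≤ x) (h1 : x < 1) :
    (circleRep (x : AddCircle (1 : ℝ)) : ℝ) = x :=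
  AddCircle.equivIco_coe_of_mem ⟨h0, by rwa [zero_add]⟩

theorem measurePreserving_circleRep : MeasurePreserving circleRep := by
  have hm : Measurable circleRep :=
    (measurable_subtype_coe.comp (AddCircle.measurableEquivIco 1 0).measurable).subtype_mk
  refine ⟨hm, ?_⟩
  have h1 : MeasurePreserving (fun x : unitInterval => ((x : ℝ) : AddCircle (1 : ℝ))) := by
    have h2 := AddCircle.measurePreserving_mk 1 0
    rw [zero_add, Measure.restrict_congr_set Ioc_ae_eq_Icc] at h2
    exact h2.comp unitInterval.measurePreserving_coe
  -- On `[0,1)` the map is a left inverse of the measure-preserving projection to the circle.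
  rw [← h1.map_eq, Measure.map_map hm h1.measurable]
  have h3 : circleRep ∘ (fun x : unitInterval => ((x : ℝ) : AddCircle (1 : ℝ))) =ᵐ[volume] id := by
    filter_upwards [ae_ne 1] with x hx
    exact Subtype.ext (circleRep_coe x.2.1 (coe_lt_one hx))
  rw [Measure.map_congr h3, Measure.map_id]

/-- The doubling map is a factor of multiplication by `2` on the circle. -/
theorem ergodic_doubling : Ergodic doubling := by
  refine measurePreserving_circleRep.ergodic_of_ergodic_semiconj
    (AddCircle.ergodic_nsmul (n := 2) one_lt_two) measurable_doubling fun z => Subtype.ext ?_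
  have h0 := (circleRep z).2.1
  have h1 := circleRep_lt_one z
  have e : 2 • z = ((2 * (circleRep z : ℝ) : ℝ) : AddCircle (1 : ℝ)) := by
    conv_lhs => rw [← coe_circleRep z]
    rw [← AddCircle.coe_nsmul]
    simp
  change (circleRep (2 • z) : ℝ) = _
  rw [e]
  by_cases h : (circleRep z : ℝ) < 1 / 2
  · rw [coe_doubling_of_lt h, circleRep_coe (by linarith) (by linarith)]
  · have e' : ((2 * (circleRep z : ℝ) : ℝ) : AddCircle (1 : ℝ)) =
        ((2 * (circleRep z : ℝ) - 1 : ℝ) : AddCircle (1 : ℝ)) := by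
      rw [AddCircle.coe_sub, AddCircle.coe_period, sub_zero]
    rw [coe_doubling_of_not_lt h, e', circleRep_coe (by linarith) (by linarith)]

/-- Almost every orbit of the doubling map visits every nonempty open set infinitely often. -/
theorem ae_frequently_mem_isOpen :
    ∀ᵐ x : unitInterval, ∀ U : Set unitInterval, IsOpen U → U.Nonempty →
      ∃ᶠ n in atTop, doubling^[n] x ∈ U := by
  have key : ∀ U : Set unitInterval, IsOpen U → U.Nonempty →
      ∀ᵐ x : unitInterval, ∃ᶠ n in atTop, doubling^[n] x ∈ U := by
    intro U hU hne
    -- The recurrent set is invariant, so it is null or conull; by Poincaré recurrence it contains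
    -- almost all of `U`.
    have hinv : doubling ⁻¹' {x | ∃ᶠ n in atTop, doubling^[n] x ∈ U} =
        {x | ∃ᶠ n in atTop, doubling^[n] x ∈ U} := by
      ext x
      have h := Filter.frequently_map (f := atTop) (m := fun n => n + 1)
        (P := fun n => doubling^[n] x ∈ U)
      rw [map_add_atTop_eq_nat] at h
      exact h.symm
    have hmeas : MeasurableSet {x | ∃ᶠ n in atTop, doubling^[n] x ∈ U} := by
      have e : {x | ∃ᶠ n in atTop, doubling^[n] x ∈ U} =
          ⋂ k, ⋃ n, ⋃ (_ : n ≥ k), doubling^[n] ⁻¹' U := by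
        ext x
        simp [frequently_atTop]
      rw [e]
      exact .iInter fun k => .iUnion fun n => .iUnion fun _ =>
        (measurable_doubling.iterate n) hU.measurableSet
    have hrec := measurePreserving_doubling.conservative.ae_mem_imp_frequently_image_mem
      hU.measurableSet.nullMeasurableSet
    rcases ergodic_doubling.toPreErgodic.prob_eq_zero_or_one hmeas hinv with h | h
    · exfalso
      have : volume U ≤ 0 := by
        rw [← h]
        exact measure_mono_ae hrec
      exact (hU.measure_pos volume hne).not_ge this
    · exact (prob_compl_eq_zero_iff hmeas).2 h
  have hB := TopologicalSpace.isBasis_countableBasis unitInterval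
  have h : ∀ᵐ x : unitInterval, ∀ U ∈ TopologicalSpace.countableBasis unitInterval,
      ∃ᶠ n in atTop, doubling^[n] x ∈ U := by
    rw [ae_ball_iff (TopologicalSpace.countable_countableBasis _)]
    exact fun U hU => key U (hB.isOpen hU) (TopologicalSpace.nonempty_of_mem_countableBasis hU)
  filter_upwards [h] with x hx U hU hne
  obtain ⟨y, hy⟩ := hne
  obtain ⟨V, hV, -, hVU⟩ := hB.exists_subset_of_mem_open hy hU
  exact (hx V hV).mono fun n hn => hVU hn

theorem ae_iterate_doubling_ne (c : unitInterval) :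
    ∀ᵐ x : unitInterval, ∀ n, doubling^[n] x ≠ c := by
  rw [ae_all_iff]
  intro n
  exact (measurePreserving_doubling.iterate n).quasiMeasurePreserving.ae (ae_ne c)

/-! ### Random products along the doubling map -/

/-- The function of `x` with value `r` on `[0,1/2)` and `s` on `[1/2,1]`. -/
noncomputable def byHalf (r s : ℝ) (x : unitInterval) : ℝ := if (x : ℝ) < 1 / 2 then r else s

/-- If the geometric mean of `r` and `s` is less than `1`, so is some power mean with positive
exponent: the power mean of order `t` tends to the geometric mean as `t → 0`. -/
theorem exists_rpow_add_rpow_lt_two {r s : ℝ} (hr : 0 < r) (hs : 0 < s) (h : r * s < 1) :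
    ∃ t : ℝ, 0 < t ∧ r ^ t + s ^ t < 2 := by
  have hd : HasDerivAt (fun t : ℝ => r ^ t + s ^ t) (Real.log (r * s)) 0 := by
    have h1 := (Real.hasStrictDerivAt_const_rpow hr 0).hasDerivAt
    have h2 := (Real.hasStrictDerivAt_const_rpow hs 0).hasDerivAt
    have h3 := h1.fun_add h2
    rw [Real.rpow_zero, Real.rpow_zero, one_mul, one_mul, ← Real.log_mul hr.ne' hs.ne'] at h3
    exact h3
  have hneg : Real.log (r * s) < 0 := Real.log_neg (mul_pos hr hs) h
  have h3 := (hasDerivAt_iff_tendsto_slope.1 hd).eventually_lt_const hneg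
  have h4 : ∀ᶠ t in 𝓝[>] (0 : ℝ), slope (fun t : ℝ => r ^ t + s ^ t) 0 t < 0 :=
    h3.filter_mono (nhdsWithin_mono _ fun t ht => ne_of_gt ht)
  obtain ⟨t, ht, ht0⟩ := (h4.and self_mem_nhdsWithin).exists
  refine ⟨t, ht0, ?_⟩
  rw [slope_def_field, sub_zero, div_neg_iff] at ht
  simp only [Real.rpow_zero] at ht
  have : (0 : ℝ) < t := ht0
  rcases ht with ht | ht <;> linarith

/-- The product of `byHalf r s` along the first `n` points of an orbit of the doubling map. -/
noncomputable def orbitProd (r s : ℝ) (n : ℕ) (x : unitInterval) : ℝ :=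
  ∏ k ∈ Finset.range n, byHalf r s (doubling^[k] x)

theorem orbitProd_succ' (r s : ℝ) (n : ℕ) (x : unitInterval) :
    orbitProd r s (n + 1) x = byHalf r s x * orbitProd r s n (doubling x) := by
  simp only [orbitProd, Finset.prod_range_succ', Function.iterate_succ_apply,
    Function.iterate_zero, id]
  exact mul_comm _ _

theorem orbitProd_succ (r s : ℝ) (n : ℕ) (x : unitInterval) :
    orbitProd r s (n + 1) x = orbitProd r s n x * byHalf r s (doubling^[n] x) :=
  Finset.prod_range_succ _ _

theorem byHalf_pos {r s : ℝ} (hr : 0 < r) (hs : 0 < s) (x : unitInterval) : 0 < byHalf r s x := by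
  unfold byHalf
  split_ifs <;> assumption

theorem orbitProd_pos {r s : ℝ} (hr : 0 < r) (hs : 0 < s) (n : ℕ) (x : unitInterval) :
    0 < orbitProd r s n x :=
  Finset.prod_pos fun _ _ => byHalf_pos hr hs _

theorem measurable_byHalf (r s : ℝ) : Measurable (byHalf r s) :=
  Measurable.ite (measurableSet_lt measurable_subtype_coe measurable_const) measurable_const
    measurable_const

theorem measurable_orbitProd (r s : ℝ) (n : ℕ) : Measurable (orbitProd r s n) :=
  Finset.measurable_fun_prod _ fun k _ =>
    (measurable_byHalf r s).comp (measurable_doubling.iterate k)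

theorem lintegral_orbitProd_rpow {r s : ℝ} (hr : 0 < r) (hs : 0 < s) (t : ℝ) (n : ℕ) :
    ∫⁻ x, ENNReal.ofReal (orbitProd r s n x ^ t) =
      (2⁻¹ * (ENNReal.ofReal (r ^ t) + ENNReal.ofReal (s ^ t))) ^ n := by
  induction n with
  | zero => simp [orbitProd]
  | succ n ih =>
    have hm : Measurable fun x => ENNReal.ofReal (orbitProd r s n x ^ t) :=
      ENNReal.measurable_ofReal.comp ((measurable_orbitProd r s n).pow_const t)
    rw [pow_succ', ← ih, ← lintegral_ite_mul_doubling _ _ hm]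
    refine lintegral_congr fun x => ?_
    rw [orbitProd_succ', Real.mul_rpow (byHalf_pos hr hs x).le (orbitProd_pos hr hs n _).le,
      ENNReal.ofReal_mul (Real.rpow_nonneg (byHalf_pos hr hs x).le t)]
    unfold byHalf
    split_ifs <;> rfl

/-- The moments of order `t` of the products decay geometrically for a suitable `t > 0`, hence are
summable, and the products tend to zero almost surely. -/
theorem ae_tendsto_orbitProd {r s : ℝ} (hr : 0 < r) (hs : 0 < s) (h : r * s < 1) :
    ∀ᵐ x : unitInterval, Tendsto (fun n => orbitProd r s n x) atTop (𝓝 0) := by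
  obtain ⟨t, ht0, ht⟩ := exists_rpow_add_rpow_lt_two hr hs h
  have hm : ∀ n, Measurable fun x => ENNReal.ofReal (orbitProd r s n x ^ t) := fun n =>
    ENNReal.measurable_ofReal.comp ((measurable_orbitProd r s n).pow_const t)
  have hlt : 2⁻¹ * (ENNReal.ofReal (r ^ t) + ENNReal.ofReal (s ^ t)) < 1 := by
    rw [← ENNReal.ofReal_add (Real.rpow_nonneg hr.le t) (Real.rpow_nonneg hs.le t)]
    have h2 : ENNReal.ofReal (r ^ t + s ^ t) < 2 := by
      rw [ENNReal.ofReal_lt_iff_lt_toReal (by positivity) (by simp)]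
      simpa using ht
    calc 2⁻¹ * ENNReal.ofReal (r ^ t + s ^ t) < 2⁻¹ * 2 :=
          ENNReal.mul_lt_mul_right (by simp) (by simp) h2
      _ = 1 := ENNReal.inv_mul_cancel (by simp) (by simp)
  have hsum : ∫⁻ x, ∑' n, ENNReal.ofReal (orbitProd r s n x ^ t) ≠ ∞ := by
    rw [lintegral_tsum fun n => (hm n).aemeasurable]
    simp only [lintegral_orbitProd_rpow hr hs]
    rw [ENNReal.tsum_geometric]
    exact ENNReal.inv_ne_top.2 (tsub_pos_of_lt hlt).ne'
  filter_upwards [ae_lt_top (Measurable.tsum hm) hsum] with x hx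
  have h1 := ENNReal.tendsto_atTop_zero_of_tsum_ne_top hx.ne
  have h2 : Tendsto (fun n => orbitProd r s n x ^ t) atTop (𝓝 0) := by
    have := (ENNReal.tendsto_toReal ENNReal.zero_ne_top).comp h1
    simp only [ENNReal.toReal_zero] at this
    refine this.congr fun n => ?_
    exact ENNReal.toReal_ofReal (Real.rpow_nonneg (orbitProd_pos hr hs n x).le t)
  have h3 := h2.rpow_const (p := t⁻¹) (Or.inr (inv_pos.2 ht0).le)
  rw [Real.zero_rpow (inv_pos.2 ht0).ne'] at h3
  refine h3.congr fun n => ?_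
  rw [← Real.rpow_mul (orbitProd_pos hr hs n x).le, mul_inv_cancel₀ ht0.ne', Real.rpow_one]

/-- Almost sure stability of the fixed point `0` of the quadratic maps `z ↦ z (1 + c (1 - z))`
applied along an orbit of the doubling map, with `c = c₀` on the left half and `c = c₁` on the
right half: the product of the multipliers `1 + c₀`, `1 + c₁` at `0` is less than `1`. -/
theorem ae_exists_forall_tendsto_zero {c₀ c₁ : ℝ} (h₀ : |c₀| ≤ 1 / 2) (h₁ : |c₁| ≤ 1 / 2)
    (h : (1 + c₀) * (1 + c₁) < 1) :
    ∀ᵐ x : unitInterval, ∃ α : ℝ, 0 < α ∧ ∀ z : ℕ → ℝ, (∀ n, 0 ≤ z n) → (∀ n, z n ≤ 1) →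
      (∀ n, z (n + 1) = z n * (1 + byHalf c₀ c₁ (doubling^[n] x) * (1 - z n))) →
      z 0 < α → Tendsto z atTop (𝓝 0) := by
  have hc₀ := abs_le.1 h₀
  have hc₁ := abs_le.1 h₁
  -- Near `0` the multipliers stay below `1 + c₀ + δ` and `1 + c₁ + δ`, still with product below 1.
  obtain ⟨δ, hδ, hδ0⟩ : ∃ δ : ℝ, (1 + c₀ + δ) * (1 + c₁ + δ) < 1 ∧ 0 < δ := by
    have hcont : Continuous fun δ : ℝ => (1 + c₀ + δ) * (1 + c₁ + δ) := by fun_prop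
    have := (hcont.tendsto 0).eventually_lt_const (u := 1) (by simpa using h)
    exact ((this.filter_mono (nhdsWithin_le_nhds (s := Set.Ioi 0))).and self_mem_nhdsWithin).exists
  have hr : 0 < 1 + c₀ + δ := by linarith
  have hs : 0 < 1 + c₁ + δ := by linarith
  filter_upwards [ae_tendsto_orbitProd hr hs hδ] with x hx
  -- An orbit starting below `δ / C` never leaves `[0, δ]`, where the products dominate it.
  obtain ⟨C, hC⟩ := hx.bddAbove_range
  have hC : ∀ n, orbitProd (1 + c₀ + δ) (1 + c₁ + δ) n x ≤ C := fun n => hC ⟨n, rfl⟩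
  have hC0 : 0 < C := (orbitProd_pos hr hs 0 x).trans_le (hC 0)
  refine ⟨δ / C, div_pos hδ0 hC0, fun z hz0 hz1 hz hlt => ?_⟩
  rw [lt_div_iff₀ hC0] at hlt
  have key : ∀ n, z n ≤ orbitProd (1 + c₀ + δ) (1 + c₁ + δ) n x * z 0 := by
    intro n
    induction n with
    | zero => simp [orbitProd]
    | succ n ih =>
      have hzδ : z n ≤ δ :=
        ih.trans (((mul_le_mul_of_nonneg_right (hC n) (hz0 0)).trans_eq (mul_comm _ _)).trans hlt.le)
      have hfac : 1 + byHalf c₀ c₁ (doubling^[n] x) * (1 - z n) ≤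
          byHalf (1 + c₀ + δ) (1 + c₁ + δ) (doubling^[n] x) := by
        have := hz0 n
        unfold byHalf
        split_ifs <;> nlinarith
      rw [hz, orbitProd_succ, mul_right_comm]
      exact mul_le_mul ih hfac (by
        have := hz0 n
        have := hz1 n
        unfold byHalf
        split_ifs <;> nlinarith) (mul_nonneg (orbitProd_pos hr hs n x).le (hz0 0))
  refine squeeze_zero hz0 key ?_
  simpa using hx.mul_const (z 0)

/-! ### Orbits and basins of the skew product -/

theorem iterate_skewMap_fst (a b : Param) (n : ℕ) (p : Square) :
    ((skewMap a b)^[n] p).1 = doubling^[n] p.1 :=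
  (Function.Semiconj.iterate_right (f := Prod.fst) (fun _ => rfl) n :
    Function.Semiconj Prod.fst (skewMap a b)^[n] doubling^[n]) p

theorem iterate_succ_skewMap_snd (a b : Param) (n : ℕ) (p : Square) :
    ((skewMap a b)^[n + 1] p).2 =
      fiberMap a b (doubling^[n] p.1) ((skewMap a b)^[n] p).2 := by
  rw [Function.iterate_succ_apply', ← iterate_skewMap_fst a b]
  rfl

theorem coe_fiberMap (a b : Param) (x y : unitInterval) :
    (fiberMap a b x y : ℝ) = y + byHalf a (-b) x * y * (1 - y) := by
  unfold fiberMap byHalf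
  split_ifs
  · rfl
  · simp only [fiberDown]
    ring

theorem fiberMap_zero (a b : Param) (x : unitInterval) : fiberMap a b x 0 = 0 :=
  Subtype.ext (by simp [coe_fiberMap])

theorem fiberMap_one (a b : Param) (x : unitInterval) : fiberMap a b x 1 = 1 :=
  Subtype.ext (by simp [coe_fiberMap])

theorem fiberMap_endpoint (a b : Param) (x : unitInterval) {i : unitInterval}
    (hi : i = 0 ∨ i = 1) : fiberMap a b x i = i := by
  rcases hi with rfl | rfl
  · exact fiberMap_zero a b x
  · exact fiberMap_one a b x

theorem abs_byHalf_le (a b : Param) (x : unitInterval) : |byHalf a (-b) x| < 1 / 2 := by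
  have ha := a.2
  have hb := b.2
  simp only [Set.mem_Ioo] at ha hb
  rw [abs_lt]
  unfold byHalf
  split_ifs <;> constructor <;> linarith

theorem fiberMap_strictMono (a b : Param) (x : unitInterval) : StrictMono (fiberMap a b x) := by
  intro y z h
  have h' : (y : ℝ) < z := h
  rw [← Subtype.coe_lt_coe, coe_fiberMap, coe_fiberMap]
  obtain ⟨hc1, hc2⟩ := abs_lt.1 (abs_byHalf_le a b x)
  have hy := y.2.1
  have hz := z.2.2
  have hz0 := z.2.1
  have hy1 := y.2.2
  nlinarith [mul_pos (sub_pos.2 h') (show 0 < 1 + byHalf a (-b) x * (1 - y - z) by nlinarith)]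

theorem continuous_fiberMap (a b : Param) (x : unitInterval) : Continuous (fiberMap a b x) := by
  refine Continuous.subtype_mk (f := fun y : unitInterval =>
    (y : ℝ) + byHalf a (-b) x * y * (1 - y)) (by fun_prop)
    (fun y => by rw [← coe_fiberMap]; exact Subtype.mem _) |>.congr fun y => ?_
  exact Subtype.ext (coe_fiberMap a b x y).symm

theorem measurable_skewMap (a b : Param) : Measurable (skewMap a b) := by
  refine (measurable_doubling.comp measurable_fst).prodMk ?_
  rw [← unitInterval.measurableEmbedding_coe.measurable_comp_iff]
  have e : ((↑) : unitInterval → ℝ) ∘ (fun p : Square => fiberMap a b p.1 p.2) =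
      fun p => (p.2 : ℝ) + byHalf a (-b) p.1 * p.2 * (1 - p.2) :=
    funext fun p => coe_fiberMap a b p.1 p.2
  rw [e]
  have h1 : Measurable fun p : Square => byHalf a (-b) p.1 :=
    (measurable_byHalf a (-b)).comp measurable_fst
  have h2 : Measurable fun p : Square => (p.2 : ℝ) := measurable_subtype_coe.comp measurable_snd
  exact h2.add ((h1.mul h2).mul (measurable_const.sub h2))

/-- In terms of the distance to the end point `i`, each fibre map again is a quadratic map fixing
`0`; for `i = 1` the signs of the parameters are exchanged. -/
theorem dist_fiberMap (a b : Param) (x y : unitInterval) {i : unitInterval} (hi : i = 0 ∨ i = 1) :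
    dist (fiberMap a b x y) i = dist y i *
      (1 + byHalf ((1 - 2 * i) * a) (-((1 - 2 * i) * b)) x * (1 - dist y i)) := by
  simp only [Subtype.dist_eq, Real.dist_eq]
  rcases hi with rfl | rfl
  · have h1 := y.2.1
    have h2 := (fiberMap a b x y).2.1
    simp only [Set.Icc.coe_zero, sub_zero, abs_of_nonneg h1, abs_of_nonneg h2, mul_zero, one_mul]
    rw [coe_fiberMap]
    ring
  · have h1 := sub_nonpos.2 y.2.2
    have h2 := sub_nonpos.2 (fiberMap a b x y).2.2
    simp only [Set.Icc.coe_one, abs_of_nonpos h1, abs_of_nonpos h2, mul_one]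
    rw [coe_fiberMap]
    unfold byHalf
    split_ifs <;> ring

/-- The point `(x, y)` is attracted by the segment `[0,1] × {i}`. -/
def Attracted (a b : Param) (i : unitInterval) (p : Square) : Prop :=
  Tendsto (fun n => ((skewMap a b)^[n] p).2) atTop (𝓝 i)

theorem isClosed_invSegment (i : unitInterval) : IsClosed (invSegment i) :=
  isClosed_singleton.preimage continuous_snd

/-- By compactness, the omega-limit set lies in the segment if and only if the orbit converges to
it. -/
theorem mem_basin_iff (a b : Param) (i : unitInterval) (p : Square) :
    p ∈ basin (skewMap a b) (invSegment i) ↔ Attracted a b i p := by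
  constructor
  · intro h
    refine tendsto_nhds.2 fun V hV hiV => ?_
    have := eventually_mapsTo_of_isOpen_of_omegaLimit_subset (f := atTop)
      (ϕ := fun n : ℕ => (skewMap a b)^[n]) (s := {p}) (hV.preimage continuous_snd)
      (Set.Subset.trans h fun q (hq : q.2 = i) => show q.2 ∈ V by rwa [hq])
    filter_upwards [this] with n hn
    exact hn rfl
  · intro h q hq
    rw [omegaSet, mem_omegaLimit_singleton_iff_mapClusterPt] at hq
    have h1 : MapClusterPt q.2 atTop (fun n => ((skewMap a b)^[n] p).2) :=
      hq.continuousAt_comp continuous_snd.continuousAt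
    exact eq_of_nhds_neBot (ClusterPt.mono h1 h)

theorem attracted_skewMap_iff (a b : Param) (i : unitInterval) (p : Square) :
    Attracted a b i (skewMap a b p) ↔ Attracted a b i p := by
  unfold Attracted
  rw [← tendsto_add_atTop_iff_nat (f := fun n => ((skewMap a b)^[n] p).2) 1]
  rfl

theorem attracted_iterate_iff (a b : Param) (i : unitInterval) (n : ℕ) (p : Square) :
    Attracted a b i ((skewMap a b)^[n] p) ↔ Attracted a b i p := by
  induction n generalizing p with
  | zero => rfl
  | succ n ih => rw [Function.iterate_succ_apply, ih, attracted_skewMap_iff]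

theorem measurableSet_attracted (a b : Param) (i : unitInterval) :
    MeasurableSet {p | Attracted a b i p} :=
  measurableSet_tendsto _ fun n => measurable_snd.comp ((measurable_skewMap a b).iterate n)

theorem iterate_snd_mono (a b : Param) (x : unitInterval) (n : ℕ) :
    Monotone fun y => ((skewMap a b)^[n] (x, y)).2 := by
  induction n with
  | zero => exact monotone_id
  | succ n ih =>
    intro y z hyz
    simp only [iterate_succ_skewMap_snd]
    exact (fiberMap_strictMono a b _).monotone (ih hyz)

theorem iterate_endpoint (a b : Param) {i : unitInterval} (hi : i = 0 ∨ i = 1) (x : unitInterval)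
    (n : ℕ) : (skewMap a b)^[n] (x, i) = (doubling^[n] x, i) := by
  have h : Function.Semiconj (fun x : unitInterval => (x, i)) doubling (skewMap a b) := fun x => by
    simp only [skewMap, fiberMap_endpoint a b x hi]
  exact (h.iterate_right n x).symm

theorem attracted_endpoint (a b : Param) {i : unitInterval} (hi : i = 0 ∨ i = 1)
    (x : unitInterval) : Attracted a b i (x, i) := by
  unfold Attracted
  simp only [iterate_endpoint a b hi]
  exact tendsto_const_nhds

/-- The end point `i` of the fibres is stable over almost every point of the base. -/
def FiberStable (a b : Param) (i : unitInterval) : Prop :=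
  ∀ᵐ x : unitInterval, ∃ α : ℝ, 0 < α ∧ ∀ y, dist y i < α → Attracted a b i (x, y)

theorem fiberStable_of_mul_lt_one (a b : Param) {i : unitInterval} (hi : i = 0 ∨ i = 1)
    (h : (1 + (1 - 2 * (i : ℝ)) * a) * (1 - (1 - 2 * (i : ℝ)) * b) < 1) : FiberStable a b i := by
  have ha := a.2
  have hb := b.2
  simp only [Set.mem_Ioo] at ha hb
  have h0 : |(1 - 2 * (i : ℝ)) * a| ≤ 1 / 2 := by
    rcases hi with rfl | rfl <;> norm_num [abs_le] <;> constructor <;> linarith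
  have h1 : |(-((1 - 2 * (i : ℝ)) * b))| ≤ 1 / 2 := by
    rcases hi with rfl | rfl <;> norm_num [abs_le] <;> constructor <;> linarith
  filter_upwards [ae_exists_forall_tendsto_zero h0 h1 (by rwa [← sub_eq_add_neg])] with x hx
  obtain ⟨α, hα, H⟩ := hx
  refine ⟨α, hα, fun y hy => tendsto_iff_dist_tendsto_zero.2 ?_⟩
  refine H _ (fun n => dist_nonneg) (fun n => ?_) (fun n => ?_) hy
  · exact Real.dist_le_of_mem_Icc_01 (Subtype.mem _) (Subtype.mem _)
  · rw [iterate_succ_skewMap_snd, dist_fiberMap a b _ _ hi]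

/-! ### The segments as attractors -/

theorem omegaSet_eq_invSegment {a b : Param} {i : unitInterval} {p : Square}
    (hp : Attracted a b i p)
    (hx : ∀ U : Set unitInterval, IsOpen U → U.Nonempty → ∃ᶠ n in atTop, doubling^[n] p.1 ∈ U) :
    omegaSet (skewMap a b) p = invSegment i := by
  refine Set.Subset.antisymm ((mem_basin_iff a b i p).2 hp) fun q (hq : q.2 = i) => ?_
  rw [omegaSet, mem_omegaLimit_singleton_iff_mapClusterPt, mapClusterPt_iff_frequently]
  intro s hs
  obtain ⟨x, y⟩ := q
  obtain rfl : y = i := hq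
  obtain ⟨U, V, hU, hxU, hV, hyV, h⟩ := mem_nhds_prod_iff'.1 hs
  refine ((hx U hU ⟨x, hxU⟩).and_eventually (hp.eventually_mem (hV.mem_nhds hyV))).mono
    fun n hn => h ⟨?_, hn.2⟩
  rw [iterate_skewMap_fst]
  exact hn.1

theorem thickening_invSegment (i : unitInterval) (δ : ℝ) :
    Metric.thickening δ (invSegment i) = Set.univ ×ˢ Metric.ball i δ := by
  ext p
  simp only [Metric.mem_thickening_iff, Set.mem_prod, Set.mem_univ, true_and, Metric.mem_ball]
  constructor
  · rintro ⟨q, hq, h⟩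
    have hq : q.2 = i := hq
    rw [← hq]
    exact (le_max_right _ _).trans_lt h
  · intro h
    refine ⟨(p.1, i), rfl, ?_⟩
    rw [Prod.dist_eq, dist_self]
    exact max_lt (dist_nonneg.trans_lt h) h

/-- The points of the base over which the whole `δ`-neighbourhood of the end point `i` of the fibre
is attracted by `[0,1] × {i}`. -/
def stableBase (a b : Param) (i : unitInterval) (δ : ℝ) : Set unitInterval :=
  {x | ∀ y, dist y i < δ → Attracted a b i (x, y)}

theorem stableBase_anti (a b : Param) (i : unitInterval) {δ ε : ℝ} (h : δ ≤ ε) :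
    stableBase a b i ε ⊆ stableBase a b i δ :=
  fun _ hx y hy => hx y (hy.trans_le h)

theorem tendsto_volume_stableBase {a b : Param} {i : unitInterval} (H : FiberStable a b i) :
    Tendsto (fun δ : ℝ => volume (stableBase a b i δ)) (𝓝[>] 0) (𝓝 1) := by
  have hmono : Monotone fun n : ℕ => stableBase a b i (1 / ((n : ℝ) + 1)) := fun m n h =>
    stableBase_anti a b i (Nat.one_div_le_one_div h)
  have h1 : Tendsto (fun n : ℕ => volume (stableBase a b i (1 / ((n : ℝ) + 1)))) atTop (𝓝 1) := by
    have h2 := tendsto_measure_iUnion_atTop (μ := volume) hmono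
    have h3 : volume (⋃ n : ℕ, stableBase a b i (1 / ((n : ℝ) + 1))) = 1 := by
      rw [← measure_univ (μ := (volume : Measure unitInterval))]
      refine measure_congr (eventuallyEq_univ.2 ?_)
      filter_upwards [H] with x hx
      obtain ⟨α, hα, h⟩ := hx
      obtain ⟨n, hn⟩ := exists_nat_one_div_lt hα
      exact Set.mem_iUnion.2 ⟨n, fun y hy => h y (hy.trans hn)⟩
    rwa [h3] at h2
  rw [tendsto_order]
  refine ⟨fun c hc => ?_, fun c hc => Eventually.of_forall fun δ => prob_le_one.trans_lt hc⟩
  obtain ⟨n, hn⟩ := (h1.eventually_const_lt hc).exists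
  have hpos : (0 : ℝ) < 1 / ((n : ℝ) + 1) := Nat.one_div_pos_of_nat
  filter_upwards [Ioo_mem_nhdsGT hpos] with δ hδ
  exact hn.trans_le (measure_mono (stableBase_anti a b i hδ.2.le))

theorem tendsto_density {a b : Param} {i : unitInterval} (H : FiberStable a b i) :
    Tendsto (fun δ : ℝ => volume (Metric.thickening δ (invSegment i) ∩
      basin (skewMap a b) (invSegment i)) / volume (Metric.thickening δ (invSegment i)))
      (𝓝[>] 0) (𝓝 1) := by
  refine tendsto_of_tendsto_of_tendsto_of_le_of_le' (tendsto_volume_stableBase H)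
    tendsto_const_nhds ?_ ?_
  · filter_upwards [self_mem_nhdsWithin] with δ hδ
    have hpos : 0 < volume (Metric.ball i δ) :=
      Metric.isOpen_ball.measure_pos volume ⟨i, Metric.mem_ball_self hδ⟩
    rw [thickening_invSegment, ENNReal.le_div_iff_mul_le
      (Or.inl (by rw [Measure.volume_eq_prod, Measure.prod_prod]; simpa using hpos.ne'))
      (Or.inl (measure_ne_top _ _))]
    rw [Measure.volume_eq_prod, Measure.prod_prod, measure_univ, one_mul, ← Measure.prod_prod]
    refine measure_mono fun p hp => ⟨⟨trivial, hp.2⟩, ?_⟩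
    exact (mem_basin_iff a b i p).2 (hp.1 p.2 hp.2)
  · exact Eventually.of_forall fun δ =>
      ENNReal.div_le_of_le_mul (by rw [one_mul]; exact measure_mono Set.inter_subset_left)

theorem doubling_surjective : Function.Surjective doubling := by
  intro x
  by_cases h : x = 1
  · refine ⟨1, Subtype.ext ?_⟩
    rw [coe_doubling_of_not_lt (by norm_num), h]
    norm_num
  · exact ⟨branch true x, doubling_branch h true⟩

theorem isMilnorAttractor_invSegment {a b : Param} {i : unitInterval} (hi : i = 0 ∨ i = 1)
    (H : FiberStable a b i) : IsMilnorAttractor volume (skewMap a b) (invSegment i) := by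
  have hpos : 0 < volume (basin (skewMap a b) (invSegment i)) := by
    rw [pos_iff_ne_zero]
    intro h0
    have h1 := (tendsto_density H).eventually_const_lt (u := 0) one_pos
    obtain ⟨δ, hδ⟩ := h1.exists
    rw [measure_mono_null Set.inter_subset_right h0, ENNReal.zero_div] at hδ
    exact lt_irrefl _ hδ
  refine ⟨(isClosed_invSegment i).isCompact, ?_, hpos, fun A' _ hA' h => ?_⟩
  · ext ⟨x, y⟩
    constructor
    · rintro ⟨⟨x', y'⟩, hy, h⟩
      obtain rfl : y' = i := hy
      rw [skewMap, fiberMap_endpoint a b _ hi] at h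
      exact (congrArg Prod.snd h).symm
    · intro hy
      obtain rfl : y = i := hy
      obtain ⟨x', rfl⟩ := doubling_surjective x
      exact ⟨(x', y), rfl, by rw [skewMap, fiberMap_endpoint a b _ hi]⟩
  · -- A point attracted by `A'` is attracted by the segment; its orbit does not accumulate on all
    -- of the segment, although almost every orbit in the base is dense.
    have hnull : volume (basin (skewMap a b) A') = 0 := by
      have hae : ∀ᵐ p : Square, ∀ U : Set unitInterval, IsOpen U → U.Nonempty →
          ∃ᶠ n in atTop, doubling^[n] p.1 ∈ U :=
        Measure.quasiMeasurePreserving_fst.ae ae_frequently_mem_isOpen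
      refine measure_mono_null (fun p hp => Set.mem_compl fun hgen => ?_) (mem_ae_iff.1 hae)
      have hp' : Attracted a b i p := (mem_basin_iff a b i p).1 (Set.Subset.trans hp hA'.1)
      have := omegaSet_eq_invSegment hp' hgen
      exact hA'.2 (this ▸ hp)
    rw [measure_congr h] at hnull
    exact hpos.ne' hnull

theorem isEssentialAttractor_invSegment {a b : Param} {i : unitInterval} (hi : i = 0 ∨ i = 1)
    (H : FiberStable a b i) : IsEssentialAttractor volume (skewMap a b) (invSegment i) :=
  ⟨isMilnorAttractor_invSegment hi H, tendsto_density H⟩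

/-! ### Chaos on the segments -/

/-- Where the orbit of `x` avoids the discontinuity `1/2`, the iterates of the skew product are
locally products of an affine map of slope `2 ^ n` and a smooth map of the fibre. -/
theorem exists_local_form (a b : Param) {x : unitInterval}
    (hx : ∀ n, (doubling^[n] x : ℝ) ≠ 1 / 2) (n : ℕ) :
    ∃ c : ℝ, ∃ G : ℝ → ℝ, Differentiable ℝ G ∧ ∀ᶠ x' : unitInterval in 𝓝 x,
      (doubling^[n] x' : ℝ) = 2 ^ n * x' - c ∧
        ∀ y, (((skewMap a b)^[n] (x', y)).2 : ℝ) = G y := by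
  induction n with
  | zero => exact ⟨0, id, differentiable_id, Eventually.of_forall fun x' => by simp⟩
  | succ n ih =>
    obtain ⟨c, G, hG, h⟩ := ih
    have hcont : Tendsto (fun x' : unitInterval => 2 ^ n * (x' : ℝ) - c) (𝓝 x)
        (𝓝 (doubling^[n] x : ℝ)) := by
      rw [h.self_of_nhds.1]
      exact Continuous.tendsto (by fun_prop) x
    rcases lt_or_gt_of_ne (hx n) with hlt | hgt
    · refine ⟨2 * c, fun y => G y + a * G y * (1 - G y), by fun_prop, ?_⟩
      filter_upwards [h, hcont.eventually_lt_const hlt] with x' hx' hx'2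
      rw [← hx'.1] at hx'2
      refine ⟨?_, fun y => ?_⟩
      · rw [Function.iterate_succ_apply', coe_doubling_of_lt hx'2, hx'.1]
        ring
      · rw [iterate_succ_skewMap_snd, coe_fiberMap, hx'.2, byHalf, if_pos hx'2]
    · refine ⟨2 * c + 1, fun y => G y + (-b) * G y * (1 - G y), by fun_prop, ?_⟩
      filter_upwards [h, hcont.eventually_const_lt hgt] with x' hx' hx'2
      rw [← hx'.1] at hx'2
      refine ⟨?_, fun y => ?_⟩
      · rw [Function.iterate_succ_apply', coe_doubling_of_not_lt hx'2.not_gt, hx'.1]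
        ring
      · rw [iterate_succ_skewMap_snd, coe_fiberMap, hx'.2, byHalf, if_neg hx'2.not_gt]

theorem totalDeriv_iterate (a b : Param) {p : Square}
    (hx : ∀ n, (doubling^[n] p.1 : ℝ) ≠ 1 / 2) (n : ℕ) :
    totalDeriv (skewMap a b)^[n] p (1, 0) = (2 ^ n, 0) := by
  obtain ⟨c, G, hG, h⟩ := exists_local_form a b hx n
  have hd : HasFDerivAt (fun q : ℝ × ℝ => (2 ^ n * q.1 - c, G q.2))
      (((2 ^ n : ℝ) • ContinuousLinearMap.fst ℝ ℝ ℝ).prod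
        ((fderiv ℝ G (toPlane p).2).comp (ContinuousLinearMap.snd ℝ ℝ ℝ))) (toPlane p) := by
    refine HasFDerivAt.prodMk ?_ ?_
    · exact ((hasFDerivAt_fst).const_mul (2 ^ n : ℝ)).sub_const c
    · exact (hG _).hasFDerivAt.comp (toPlane p) hasFDerivAt_snd
  have hproj : Tendsto (fun q : ℝ × ℝ => Set.projIcc (0 : ℝ) 1 zero_le_one q.1)
      (𝓝[Set.Icc 0 1 ×ˢ Set.Icc 0 1] toPlane p) (𝓝 p.1) := by
    have : Continuous fun q : ℝ × ℝ => Set.projIcc (0 : ℝ) 1 zero_le_one q.1 :=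
      continuous_projIcc.comp continuous_fst
    have h2 := this.tendsto (toPlane p)
    rw [show Set.projIcc (0 : ℝ) 1 zero_le_one (toPlane p).1 = p.1 from
      Set.projIcc_val zero_le_one p.1] at h2
    exact h2.mono_left nhdsWithin_le_nhds
  have heq : planeMap (skewMap a b)^[n] =ᶠ[𝓝[Set.Icc 0 1 ×ˢ Set.Icc 0 1] toPlane p]
      fun q : ℝ × ℝ => (2 ^ n * q.1 - c, G q.2) := by
    filter_upwards [hproj.eventually h, self_mem_nhdsWithin] with q hq hqs
    rw [planeMap, toPlane, iterate_skewMap_fst, hq.1, hq.2, Set.projIcc_of_mem _ hqs.1,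
      Set.projIcc_of_mem _ hqs.2]
  have hmem : toPlane p ∈ (Set.Icc 0 1 ×ˢ Set.Icc 0 1 : Set (ℝ × ℝ)) := ⟨p.1.2, p.2.2⟩
  have hu : UniqueDiffWithinAt ℝ (Set.Icc 0 1 ×ˢ Set.Icc 0 1 : Set (ℝ × ℝ)) (toPlane p) :=
    ((uniqueDiffOn_Icc zero_lt_one).prod (uniqueDiffOn_Icc zero_lt_one)) _ hmem
  rw [totalDeriv, ((hd.hasFDerivWithinAt).congr_of_eventuallyEq heq
    (heq.self_of_nhdsWithin hmem)).fderivWithin hu]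
  simp

theorem isLyapunovExponent_log_two (a b : Param) {p : Square}
    (hx : ∀ n, (doubling^[n] p.1 : ℝ) ≠ 1 / 2) :
    IsLyapunovExponent (skewMap a b) p (1, 0) (Real.log 2) := by
  refine tendsto_const_nhds.congr' ?_
  filter_upwards [eventually_ne_atTop 0] with n hn
  have hnorm : ‖((2 ^ n, 0) : ℝ × ℝ)‖ = 2 ^ n := by
    rw [Prod.norm_def, norm_zero, max_eq_left (norm_nonneg _)]
    simp
  rw [totalDeriv_iterate a b hx, hnorm, Real.log_pow]
  field_simp

/-- Lebesgue measure on the segment `[0,1] × {i}`. -/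
noncomputable def segmentMeasure (i : unitInterval) : Measure Square :=
  volume.map fun x => (x, i)

theorem measurable_toSegment (i : unitInterval) : Measurable fun x : unitInterval => (x, i) :=
  measurable_id.prodMk measurable_const

theorem support_segmentMeasure (i : unitInterval) : (segmentMeasure i).support = invSegment i := by
  refine Set.Subset.antisymm ?_ fun p hp => ?_
  · refine Measure.support_subset_of_isClosed (isClosed_invSegment i) ?_
    rw [segmentMeasure, mem_ae_map_iff (measurable_toSegment i).aemeasurable
      (isClosed_invSegment i).measurableSet]
    exact Eventually.of_forall fun _ => rfl
  · obtain ⟨x, y⟩ := p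
    obtain rfl : y = i := hp
    rw [Measure.mem_support_iff_forall]
    intro U hU
    have hc : Continuous fun x : unitInterval => (x, y) := by fun_prop
    exact (Measure.measure_pos_of_mem_nhds volume (hc.continuousAt.preimage_mem_nhds hU)).trans_le
      (Measure.le_map_apply hc.measurable.aemeasurable U)

theorem ergodic_segmentMeasure (a b : Param) {i : unitInterval} (hi : i = 0 ∨ i = 1) :
    Ergodic (skewMap a b) (segmentMeasure i) := by
  refine MeasurePreserving.ergodic_of_ergodic_semiconj (g := fun x : unitInterval => (x, i))
    ⟨measurable_toSegment i, rfl⟩ ergodic_doubling (measurable_skewMap a b) fun x => ?_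
  exact (iterate_endpoint a b hi x 1).symm

theorem ergodic_dirac {X : Type*} [MeasurableSpace X] [MeasurableSingletonClass X] {f : X → X}
    (hf : Measurable f) {x : X} (hx : f x = x) : Ergodic f (Measure.dirac x) := by
  refine ⟨⟨hf, by rw [Measure.map_dirac' hf, hx]⟩, ⟨fun s _ _ => ?_⟩⟩
  rw [ae_dirac_eq, eventuallyConst_set]
  exact em _

theorem isChaoticAttractor_invSegment {a b : Param} {i : unitInterval} (hi : i = 0 ∨ i = 1)
    (H : FiberStable a b i) : IsChaoticAttractor (skewMap a b) (invSegment i) := by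
  refine ⟨isMilnorAttractor_invSegment hi H, ?_, segmentMeasure i,
    Measure.isProbabilityMeasure_map (measurable_toSegment i).aemeasurable,
    ergodic_segmentMeasure a b hi, support_segmentMeasure i, ?_, Measure.dirac (0, i),
    inferInstance, ergodic_dirac (measurable_skewMap a b) ?_, ?_, fun h => ?_⟩
  · obtain ⟨x, hx⟩ := ae_frequently_mem_isOpen.exists
    exact ⟨(x, i), rfl, omegaSet_eq_invSegment (attracted_endpoint a b hi x) hx⟩
  · refine ⟨Real.log 2, Real.log_pos one_lt_two, ?_⟩
    have h : ∀ᵐ p ∂segmentMeasure i, ∀ n, (doubling^[n] p.1 : ℝ) ≠ 1 / 2 := by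
      have hq : Measure.QuasiMeasurePreserving Prod.fst (segmentMeasure i) volume := by
        refine ⟨measurable_fst, ?_⟩
        rw [segmentMeasure, Measure.map_map measurable_fst (measurable_toSegment i)]
        exact (Measure.map_id (μ := (volume : Measure unitInterval))).absolutelyContinuous
      filter_upwards [hq.ae (ae_iterate_doubling_ne ⟨1 / 2, by norm_num, by norm_num⟩)]
        with p hp n hn
      exact hp n (Subtype.ext hn)
    filter_upwards [h] with p hp
    exact ⟨(1, 0), isLyapunovExponent_log_two a b hp⟩
  · have h0 : doubling 0 = 0 := Subtype.ext (by rw [coe_doubling_of_lt (by norm_num)]; simp)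
    rw [skewMap, h0, fiberMap_endpoint a b 0 hi]
  · rw [Measure.dirac_apply' _ (isClosed_invSegment i).measurableSet.compl]
    simp [invSegment]
  · have h1 := congrArg (fun μ : Measure Square => μ {((0 : unitInterval), i)}) h
    simp only [segmentMeasure] at h1
    rw [Measure.map_apply (measurable_toSegment i) (measurableSet_singleton _),
      Measure.dirac_apply_of_mem (Set.mem_singleton _)] at h1
    have h2 : (fun x : unitInterval => (x, i)) ⁻¹' {((0 : unitInterval), i)} = {0} := by
      ext x
      simp
    rw [h2, measure_singleton] at h1
    exact one_ne_zero h1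

/-! ### Prescribed itineraries -/

/-- The inverse branch of an iterate of the doubling map along which the orbit has the itinerary
`w`. -/
noncomputable def wordBranch (w : List Bool) (t : unitInterval) : unitInterval :=
  w.foldr branch t

/-- The composition of the fibre maps along an orbit of itinerary `w`. -/
noncomputable def wordFiber (a b : Param) (w : List Bool) (y : unitInterval) : unitInterval :=
  w.foldl (fun y d => if d then fiberDown b y else fiberUp a y) y

theorem wordBranch_ne_one {t : unitInterval} (ht : t ≠ 1) (w : List Bool) : wordBranch w t ≠ 1 := by
  induction w with
  | nil => exact ht
  | cons d w ih => exact branch_ne_one ih d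

theorem iterate_wordBranch (a b : Param) {t : unitInterval} (ht : t ≠ 1) (w : List Bool)
    (y : unitInterval) :
    (skewMap a b)^[w.length] (wordBranch w t, y) = (t, wordFiber a b w y) := by
  induction w generalizing y with
  | nil => rfl
  | cons d w ih =>
    have hw := wordBranch_ne_one ht w
    have h1 : skewMap a b (wordBranch (d :: w) t, y) =
        (wordBranch w t, if d then fiberDown b y else fiberUp a y) := by
      change (doubling (branch d (wordBranch w t)), fiberMap a b (branch d (wordBranch w t)) y) = _
      rw [doubling_branch hw, fiberMap]
      simp only [branch_lt_half_iff hw]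
      cases d <;> simp
    rw [List.length_cons, Function.iterate_succ_apply, h1, ih]
    rfl

theorem continuous_wordBranch (w : List Bool) : Continuous (wordBranch w) := by
  induction w with
  | nil => exact continuous_id
  | cons d w ih => exact (continuous_branch d).comp ih

theorem continuous_fiberStep (a b : Param) (d : Bool) :
    Continuous fun y => if d then fiberDown b y else fiberUp a y := by
  cases d
  · simp only [Bool.false_eq_true, if_false, fiberUp]
    fun_prop
  · simp only [if_true, fiberDown]
    fun_prop

theorem continuous_wordFiber (a b : Param) (w : List Bool) : Continuous (wordFiber a b w) := by
  induction w with
  | nil => exact continuous_id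
  | cons d w ih => exact ih.comp (continuous_fiberStep a b d)

theorem dist_branch (d : Bool) (s t : unitInterval) :
    dist (branch d s) (branch d t) = dist s t / 2 := by
  simp only [Subtype.dist_eq, Real.dist_eq, coe_branch]
  rw [← sub_div, abs_div, abs_two, add_sub_add_right_eq_sub]

theorem exists_branch_doubling (x : unitInterval) : ∃ d, branch d (doubling x) = x := by
  by_cases h : (x : ℝ) < 1 / 2
  · exact ⟨false, Subtype.ext (by rw [coe_branch, coe_doubling_of_lt h, digit]; simp)⟩
  · exact ⟨true, Subtype.ext (by rw [coe_branch, coe_doubling_of_not_lt h, digit]; simp)⟩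

/-- Dyadic intervals around `x` of every level. -/
theorem exists_wordBranch_close (x : unitInterval) (n : ℕ) :
    ∃ w : List Bool, ∀ t, dist (wordBranch w t) x ≤ (1 / 2) ^ n := by
  induction n generalizing x with
  | zero => exact ⟨[], fun t => (Real.dist_le_of_mem_Icc_01 t.2 x.2).trans_eq (pow_zero _).symm⟩
  | succ n ih =>
    obtain ⟨d, hd⟩ := exists_branch_doubling x
    obtain ⟨w, hw⟩ := ih (doubling x)
    refine ⟨d :: w, fun t => ?_⟩
    conv_lhs => rw [← hd]
    change dist (branch d (wordBranch w t)) _ ≤ _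
    rw [dist_branch, pow_succ]
    linarith [hw t]

theorem quasiMeasurePreserving_branch (d : Bool) : Measure.QuasiMeasurePreserving (branch d) := by
  refine ⟨(continuous_branch d).measurable, ?_⟩
  conv_rhs => rw [volume_eq_sum_map_branch]
  refine Measure.AbsolutelyContinuous.trans ?_ (Measure.absolutelyContinuous_smul (by simp))
  refine Measure.absolutelyContinuous_of_le ?_
  cases d
  · exact Measure.le_add_right le_rfl
  · exact Measure.le_add_left le_rfl

theorem quasiMeasurePreserving_wordBranch (w : List Bool) :
    Measure.QuasiMeasurePreserving (wordBranch w) := by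
  induction w with
  | nil => exact Measure.QuasiMeasurePreserving.id _
  | cons d w ih => exact (quasiMeasurePreserving_branch d).comp ih

/-- A set whose part in the dyadic column of `w` contains a rescaled product of sets of positive
measure has positive measure. -/
theorem volume_pos_of_wordBranch (w : List Bool) {S J : Set unitInterval} (hS : 0 < volume S)
    (hJ : 0 < volume J) {T : Set Square} (h : ∀ t ∈ S, ∀ y ∈ J, (wordBranch w t, y) ∈ T) :
    0 < volume T := by
  have hq : Measure.QuasiMeasurePreserving (fun p : Square => (wordBranch w p.1, p.2)) := by
    refine ⟨((continuous_wordBranch w).measurable.comp measurable_fst).prodMk measurable_snd, ?_⟩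
    have h1 := (quasiMeasurePreserving_wordBranch w).absolutelyContinuous.prod
      (Measure.AbsolutelyContinuous.refl (volume : Measure unitInterval))
    rw [← Measure.map_id (μ := (volume : Measure unitInterval)),
      Measure.map_prod_map _ _ (continuous_wordBranch w).measurable measurable_id,
      Measure.map_id] at h1
    exact h1
  rw [pos_iff_ne_zero]
  intro h0
  have h1 : volume (S ×ˢ J) = 0 :=
    measure_mono_null (fun p hp => h p.1 hp.1 p.2 hp.2) (hq.preimage_null h0)
  rw [Measure.volume_eq_prod, Measure.prod_prod, mul_eq_zero] at h1
  exact h1.elim hS.ne' hJ.ne'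

theorem fiberStep_eq_fiberMap (a b : Param) (d : Bool) (y : unitInterval) :
    (if d then fiberDown b y else fiberUp a y) = fiberMap a b (if d then 1 else 0) y := by
  unfold fiberMap
  cases d <;> norm_num

theorem wordFiber_ne (a b : Param) {i : unitInterval} (hi : i = 0 ∨ i = 1) (w : List Bool)
    {y : unitInterval} (hy : y ≠ i) : wordFiber a b w y ≠ i := by
  induction w generalizing y with
  | nil => exact hy
  | cons d w ih =>
    refine ih (y := if d then fiberDown b y else fiberUp a y) fun h => hy ?_
    rw [fiberStep_eq_fiberMap] at h
    exact (fiberMap_strictMono a b _).injective (h.trans (fiberMap_endpoint a b _ hi).symm)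

open unitInterval in
/-- One of the two fibre maps pushes all points except the opposite end point towards `j`. -/
theorem exists_tendsto_wordFiber_replicate (a b : Param) {j : unitInterval} (hj : j = 0 ∨ j = 1) :
    ∃ d, ∀ y ≠ σ j, Tendsto (fun N => wordFiber a b (List.replicate N d) y) atTop (𝓝 j) := by
  obtain ⟨d, c, hc0, hc1, hd⟩ : ∃ d : Bool, ∃ c : ℝ, 0 < c ∧ c < 1 ∧ ∀ y,
      dist (if d then fiberDown b y else fiberUp a y) j =
        dist y j * (1 - c * (1 - dist y j)) := by
    have ha := a.2
    have hb := b.2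
    simp only [Set.mem_Ioo] at ha hb
    rcases hj with rfl | rfl
    · refine ⟨true, b, hb.1, by linarith, fun y => ?_⟩
      rw [fiberStep_eq_fiberMap, dist_fiberMap a b _ _ (Or.inl rfl), byHalf, if_neg (by norm_num)]
      simp only [Set.Icc.coe_zero]
      ring
    · refine ⟨false, a, ha.1, by linarith, fun y => ?_⟩
      rw [fiberStep_eq_fiberMap, dist_fiberMap a b _ _ (Or.inr rfl), byHalf, if_pos (by norm_num)]
      simp only [Set.Icc.coe_one]
      ring
  refine ⟨d, fun y hy => ?_⟩
  have hlt : dist y j < 1 := by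
    have h0 := y.2.1
    have h1 := y.2.2
    rcases hj with rfl | rfl
    · rw [symm_zero] at hy
      rw [Subtype.dist_eq, Real.dist_eq, Set.Icc.coe_zero, sub_zero, abs_of_nonneg h0]
      exact coe_lt_one hy
    · rw [symm_one] at hy
      have : 0 < (y : ℝ) := lt_of_le_of_ne h0 fun h => hy (Subtype.ext h.symm)
      rw [Subtype.dist_eq, Real.dist_eq, Set.Icc.coe_one, abs_lt]
      constructor <;> linarith
  -- The distance to `j` does not increase, so the contraction factor at `y` serves all later steps.
  have hr0 : 0 ≤ 1 - c * (1 - dist y j) := by nlinarith [dist_nonneg (x := y) (y := j)]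
  have hr1 : 1 - c * (1 - dist y j) < 1 := by nlinarith
  have key : ∀ N u, dist u j ≤ dist y j → dist (wordFiber a b (List.replicate N d) u) j ≤
      (1 - c * (1 - dist y j)) ^ N * dist u j := by
    intro N
    induction N with
    | zero => intro u _; simp [wordFiber]
    | succ N ih =>
      intro u hu
      have h0 : (0 : ℝ) ≤ dist u j := dist_nonneg
      have h1 : dist (if d then fiberDown b u else fiberUp a u) j ≤
          (1 - c * (1 - dist y j)) * dist u j := by
        rw [hd, mul_comm]
        gcongr
      have h2 := ih _ (h1.trans ((mul_le_of_le_one_left h0 hr1.le).trans hu))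
      rw [List.replicate_succ]
      refine h2.trans ?_
      rw [pow_succ, mul_assoc]
      gcongr
  rw [tendsto_iff_dist_tendsto_zero]
  refine squeeze_zero (fun _ => dist_nonneg) (fun N => key N y le_rfl) ?_
  simpa using (tendsto_pow_atTop_nhds_zero_of_lt_one hr0 hr1).mul_const (dist y j)

open unitInterval in
/-- From every ball, a set of points of positive measure is carried at a common time close to the
segment `[0,1] × {j}`, over any prescribed set of positive measure in the base: a dyadic column
inside the ball is spread over the whole base, then pushed along the branch favourable to `j`. -/
theorem exists_time_forall_volume_pos (a b : Param) {j : unitInterval} (hj : j = 0 ∨ j = 1)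
    (p : Square) {ε η : ℝ} (hε : 0 < ε) (hη : 0 < η) :
    ∃ n : ℕ, ∀ S : Set unitInterval, 0 < volume S → ∀ T : Set Square,
      (∀ q ∈ Metric.ball p ε, ((skewMap a b)^[n] q).1 ∈ S →
        dist ((skewMap a b)^[n] q).2 j < η → q ∈ T) → 0 < volume T := by
  have hσ : σ j = 0 ∨ σ j = 1 := by
    rcases hj with rfl | rfl
    · exact Or.inr symm_zero
    · exact Or.inl symm_one
  obtain ⟨d, hd⟩ := exists_tendsto_wordFiber_replicate a b hj
  obtain ⟨m, hm⟩ := exists_pow_lt_of_lt_one hε (show (1 / 2 : ℝ) < 1 by norm_num)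
  obtain ⟨w₁, hw₁⟩ := exists_wordBranch_close p.1 m
  obtain ⟨y₀, hy₀, hy₀j⟩ : ∃ y₀ ∈ Metric.ball p.2 ε, y₀ ≠ σ j := by
    obtain ⟨y₀, h, h'⟩ := (dense_compl_singleton (σ j)).exists_mem_open
      (Metric.isOpen_ball (x := p.2) (ε := ε)) ⟨_, Metric.mem_ball_self hε⟩
    exact ⟨y₀, h', h⟩
  obtain ⟨N, hN⟩ := ((hd _ (wordFiber_ne a b hσ w₁ hy₀j)).eventually_mem
    (Metric.ball_mem_nhds j hη)).exists
  set w := w₁ ++ List.replicate N d with hw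
  have hwF : wordFiber a b w y₀ ∈ Metric.ball j η := by
    rw [hw, wordFiber, List.foldl_append]
    exact hN
  refine ⟨w.length, fun S hS T hT => ?_⟩
  have hJ : IsOpen (Metric.ball p.2 ε ∩ wordFiber a b w ⁻¹' Metric.ball j η) :=
    Metric.isOpen_ball.inter (Metric.isOpen_ball.preimage (continuous_wordFiber a b w))
  have hS' : 0 < volume (S \ {1}) := by
    rwa [measure_sdiff_null (measure_singleton _)]
  refine volume_pos_of_wordBranch w hS' (hJ.measure_pos volume ⟨y₀, hy₀, hwF⟩) fun t ht y hy => ?_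
  have hit := iterate_wordBranch a b (show t ≠ 1 from ht.2) w y
  refine hT _ ?_ (by rw [hit]; exact ht.1) (by rw [hit]; exact hy.2)
  have hclose : dist (wordBranch w t) p.1 < ε := by
    rw [hw, wordBranch, List.foldr_append]
    exact (hw₁ _).trans_lt hm
  exact max_lt hclose hy.1

theorem hasLocallyRiddledBasin_invSegment {a b : Param} {i : unitInterval} (hi : i = 0 ∨ i = 1)
    (H : FiberStable a b i) :
    HasLocallyRiddledBasin volume (skewMap a b) (invSegment i) := by
  have hσ : unitInterval.symm i = 0 ∨ unitInterval.symm i = 1 := by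
    rcases hi with rfl | rfl
    · exact Or.inr unitInterval.symm_zero
    · exact Or.inl unitInterval.symm_one
  have hdist : dist i (unitInterval.symm i) = 1 := by
    rcases hi with rfl | rfl <;> simp [Subtype.dist_eq, Real.dist_eq]
  refine ⟨isMilnorAttractor_invSegment hi H, Prod.snd ⁻¹' Metric.ball i (1 / 2), ?_, ?_⟩
  · refine (Metric.isOpen_ball.preimage continuous_snd).mem_nhdsSet.2 fun q (hq : q.2 = i) => ?_
    rw [Set.mem_preimage, hq]
    exact Metric.mem_ball_self (by norm_num)
  · intro x _ ε hε
    obtain ⟨n, hn⟩ := exists_time_forall_volume_pos a b hσ x hε (show (0 : ℝ) < 1 / 2 by norm_num)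
    refine hn Set.univ (by simp) _ fun q hq _ hq2 => ⟨hq, fun hall => ?_⟩
    have h1 : dist ((skewMap a b)^[n] q).2 i < 1 / 2 := Set.mem_iInter.1 hall n
    have := dist_triangle_left i (unitInterval.symm i) ((skewMap a b)^[n] q).2
    linarith

theorem isRiddledWith_invSegment {a b : Param} {i j : unitInterval} (hi : i = 0 ∨ i = 1)
    (hj : j = 0 ∨ j = 1) (hij : i ≠ j) (Hi : FiberStable a b i) (Hj : FiberStable a b j) :
    IsRiddledWith volume (skewMap a b) (invSegment i) (invSegment j) := by
  refine ⟨isMilnorAttractor_invSegment hi Hi, isMilnorAttractor_invSegment hj Hj, fun h => hij ?_,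
    fun p ε hε => ?_⟩
  · have : ((0 : unitInterval), i) ∈ invSegment j := h ▸ (rfl : _ = i)
    exact this
  · obtain ⟨η, hη, hη0⟩ := (((tendsto_volume_stableBase Hj).eventually_const_lt
      (zero_lt_one (α := ℝ≥0∞))).and self_mem_nhdsWithin).exists
    obtain ⟨n, hn⟩ := exists_time_forall_volume_pos a b hj p hε hη0
    refine hn _ hη _ fun q hq hq1 hq2 => ⟨hq, (mem_basin_iff a b j q).2 ?_⟩
    exact (attracted_iterate_iff a b j n q).1 (hq1 _ hq2)

/-! ### The separating graph -/

theorem attracted_zero_of_le {a b : Param} {x y z : unitInterval} (hyz : y ≤ z)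
    (h : Attracted a b 0 (x, z)) : Attracted a b 0 (x, y) :=
  tendsto_of_tendsto_of_tendsto_of_le_of_le tendsto_const_nhds h (fun _ => unitInterval.nonneg')
    fun n => iterate_snd_mono a b x n hyz

theorem attracted_one_of_le {a b : Param} {x y z : unitInterval} (hyz : y ≤ z)
    (h : Attracted a b 1 (x, y)) : Attracted a b 1 (x, z) :=
  tendsto_of_tendsto_of_tendsto_of_le_of_le h tendsto_const_nhds
    (fun n => iterate_snd_mono a b x n hyz) fun _ => unitInterval.le_one'

/-- The upper boundary of the basin of the lower segment; the supremum is taken in the complete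
lattice `[0,1]`, and the set contains `0`. -/
noncomputable def lowerGraph (a b : Param) (x : unitInterval) : unitInterval :=
  sSup {y | Attracted a b 0 (x, y)}

/-- The lower boundary of the basin of the upper segment, an infimum in the complete lattice
`[0,1]`. -/
noncomputable def upperGraph (a b : Param) (x : unitInterval) : unitInterval :=
  sInf {y | Attracted a b 1 (x, y)}

theorem lt_lowerGraph_iff {a b : Param} {x y : unitInterval} :
    y < lowerGraph a b x ↔ ∃ z, Attracted a b 0 (x, z) ∧ y < z :=
  lt_sSup_iff

theorem upperGraph_lt_iff {a b : Param} {x y : unitInterval} :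
    upperGraph a b x < y ↔ ∃ z, Attracted a b 1 (x, z) ∧ z < y :=
  sInf_lt_iff

theorem lowerGraph_le_upperGraph (a b : Param) (x : unitInterval) :
    lowerGraph a b x ≤ upperGraph a b x := by
  refine sSup_le fun y hy => le_sInf fun z hz => le_of_not_gt fun h => ?_
  have hz' : Attracted a b 0 (x, z) := attracted_zero_of_le h.le hy
  exact zero_ne_one (tendsto_nhds_unique hz' hz)

theorem fiberMap_surjective (a b : Param) (x : unitInterval) :
    Function.Surjective (fiberMap a b x) := by
  intro y
  have h := intermediate_value_univ 0 1 (continuous_fiberMap a b x)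
  rw [fiberMap_zero, fiberMap_one] at h
  exact h ⟨unitInterval.nonneg', unitInterval.le_one'⟩

/-- Each fibre map, as an automorphism of the order on `[0,1]`. -/
noncomputable def fiberIso (a b : Param) (x : unitInterval) : unitInterval ≃o unitInterval :=
  (fiberMap_strictMono a b x).orderIsoOfSurjective _ (fiberMap_surjective a b x)

theorem image_fiberMap_attracted (a b : Param) (i x : unitInterval) :
    fiberIso a b x '' {y | Attracted a b i (x, y)} = {y | Attracted a b i (doubling x, y)} := by
  ext z
  obtain ⟨y, rfl⟩ := (fiberIso a b x).surjective z
  rw [(fiberIso a b x).injective.mem_set_image]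
  exact (attracted_skewMap_iff a b i (x, y)).symm

theorem fiberMap_lowerGraph (a b : Param) (x : unitInterval) :
    fiberMap a b x (lowerGraph a b x) = lowerGraph a b (doubling x) := by
  rw [lowerGraph, lowerGraph, ← image_fiberMap_attracted, sSup_image, ← OrderIso.map_sSup]
  rfl

theorem fiberMap_upperGraph (a b : Param) (x : unitInterval) :
    fiberMap a b x (upperGraph a b x) = upperGraph a b (doubling x) := by
  rw [upperGraph, upperGraph, ← image_fiberMap_attracted, sInf_image, ← OrderIso.map_sInf]
  rfl

theorem measurableSet_fiber_attracted (a b : Param) (i y : unitInterval) :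
    MeasurableSet {x | Attracted a b i (x, y)} :=
  measurable_prodMk_right (measurableSet_attracted a b i)

theorem measurable_lowerGraph (a b : Param) : Measurable (lowerGraph a b) := by
  obtain ⟨D, hDc, hD⟩ := TopologicalSpace.exists_countable_dense unitInterval
  refine measurable_of_Ioi fun y => ?_
  have e : lowerGraph a b ⁻¹' Set.Ioi y =
      ⋃ r ∈ D, ⋃ (_ : y < r), {x | Attracted a b 0 (x, r)} := by
    ext x
    simp only [Set.mem_preimage, Set.mem_Ioi, Set.mem_iUnion, lt_lowerGraph_iff]
    constructor
    · rintro ⟨z, hz, hyz⟩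
      obtain ⟨r, hr, hyr, hrz⟩ := hD.exists_between hyz
      exact ⟨r, hr, hyr, attracted_zero_of_le hrz.le hz⟩
    · rintro ⟨r, -, hyr, hr⟩
      exact ⟨r, hr, hyr⟩
  rw [e]
  exact .biUnion hDc fun r _ => .iUnion fun _ => measurableSet_fiber_attracted a b 0 r

theorem measurable_upperGraph (a b : Param) : Measurable (upperGraph a b) := by
  obtain ⟨D, hDc, hD⟩ := TopologicalSpace.exists_countable_dense unitInterval
  refine measurable_of_Iio fun y => ?_
  have e : upperGraph a b ⁻¹' Set.Iio y =
      ⋃ r ∈ D, ⋃ (_ : r < y), {x | Attracted a b 1 (x, r)} := by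
    ext x
    simp only [Set.mem_preimage, Set.mem_Iio, Set.mem_iUnion, upperGraph_lt_iff]
    constructor
    · rintro ⟨z, hz, hzy⟩
      obtain ⟨r, hr, hzr, hry⟩ := hD.exists_between hzy
      exact ⟨r, hr, hry, attracted_one_of_le hzr.le hz⟩
    · rintro ⟨r, -, hry, hr⟩
      exact ⟨r, hr, hry⟩
  rw [e]
  exact .biUnion hDc fun r _ => .iUnion fun _ => measurableSet_fiber_attracted a b 1 r

theorem ae_lowerGraph_pos {a b : Param} (H : FiberStable a b 0) :
    ∀ᵐ x, 0 < lowerGraph a b x := by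
  filter_upwards [H] with x hx
  obtain ⟨α, hα, h⟩ := hx
  obtain ⟨y, hy, hy0⟩ := (dense_compl_singleton (0 : unitInterval)).exists_mem_open
    (Metric.isOpen_ball (x := 0) (ε := α)) ⟨_, Metric.mem_ball_self hα⟩
  exact lt_lowerGraph_iff.2 ⟨y, h y hy0, lt_of_le_of_ne unitInterval.nonneg' (Ne.symm hy)⟩

theorem ae_upperGraph_lt_one {a b : Param} (H : FiberStable a b 1) :
    ∀ᵐ x, upperGraph a b x < 1 := by
  filter_upwards [H] with x hx
  obtain ⟨α, hα, h⟩ := hx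
  obtain ⟨y, hy, hy0⟩ := (dense_compl_singleton (1 : unitInterval)).exists_mem_open
    (Metric.isOpen_ball (x := 1) (ε := α)) ⟨_, Metric.mem_ball_self hα⟩
  exact upperGraph_lt_iff.2 ⟨y, h y hy0, lt_of_le_of_ne unitInterval.le_one' hy⟩

/-- The cross-ratio of the four points `0, p, q, 1`. -/
noncomputable def crossRatio (p q : ℝ) : ℝ := p * (1 - q) / (q * (1 - p))

theorem crossRatio_nonneg {p q : unitInterval} : 0 ≤ crossRatio p q :=
  div_nonneg (mul_nonneg p.2.1 (sub_nonneg.2 q.2.2)) (mul_nonneg q.2.1 (sub_nonneg.2 p.2.2))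

theorem crossRatio_le_one {p q : unitInterval} (h : p ≤ q) : crossRatio p q ≤ 1 := by
  have h' : (p : ℝ) ≤ q := h
  exact div_le_one_of_le₀ (by nlinarith) (mul_nonneg q.2.1 (sub_nonneg.2 p.2.2))

/-- Quadratic maps of the interval fixing both end points have negative Schwarzian derivative, and
therefore move the cross-ratio of the end points and two interior points away from `1`. -/
theorem crossRatio_quadratic_lt {c p q : ℝ} (hc : |c| < 1 / 2) (hc0 : c ≠ 0) (hp : 0 < p)
    (hpq : p < q) (hq : q < 1) :
    crossRatio (p + c * p * (1 - p)) (q + c * q * (1 - q)) < crossRatio p q := by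
  obtain ⟨h1, h2⟩ := abs_lt.1 hc
  have pos : ∀ u : ℝ, 0 < u → u < 1 → 0 < 1 + c * (1 - u) ∧ 0 < 1 - c * u := fun u h0 h1 =>
    ⟨by nlinarith, by nlinarith⟩
  obtain ⟨hp1, hp2⟩ := pos p hp (hpq.trans hq)
  obtain ⟨hq1, hq2⟩ := pos q (hp.trans hpq) hq
  have hq0 : 0 < q := hp.trans hpq
  have hp3 : 0 < 1 - p := by linarith
  have hq3 : 0 < 1 - q := by linarith
  have e : crossRatio (p + c * p * (1 - p)) (q + c * q * (1 - q)) =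
      crossRatio p q * (((1 + c * (1 - p)) * (1 - c * q)) / ((1 + c * (1 - q)) * (1 - c * p))) := by
    unfold crossRatio
    rw [div_mul_div_comm]
    congr 1 <;> ring
  rw [e]
  refine mul_lt_of_lt_one_right (by unfold crossRatio; positivity) ?_
  rw [div_lt_one (mul_pos hq1 hp2)]
  have hc2 : 0 < c ^ 2 := by positivity
  nlinarith [mul_pos hc2 (sub_pos.2 hpq)]

theorem byHalf_ne_zero (a b : Param) (x : unitInterval) : byHalf a (-b) x ≠ 0 := by
  unfold byHalf
  split_ifs
  · exact a.2.1.ne'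
  · exact (neg_neg_of_pos b.2.1).ne

/-- A bounded measurable function that does not increase along a measure-preserving map is almost
everywhere invariant. -/
theorem ae_comp_eq_of_comp_le {X : Type*} [MeasurableSpace X] {μ : Measure X} [IsFiniteMeasure μ]
    {f : X → X} (hf : MeasurePreserving f μ μ) {h : X → ℝ} (hm : Measurable h) {C : ℝ}
    (hC : ∀ x, |h x| ≤ C) (hle : ∀ᵐ x ∂μ, h (f x) ≤ h x) : ∀ᵐ x ∂μ, h (f x) = h x := by
  have hi : Integrable h μ := .of_bound hm.aestronglyMeasurable C (ae_of_all _ hC)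
  have hi' : Integrable (fun x => h (f x)) μ := hf.integrable_comp_of_integrable hi
  have h0 : ∫ x, (h x - h (f x)) ∂μ = 0 := by
    rw [integral_sub hi hi', sub_eq_zero]
    conv_lhs => rw [← hf.map_eq]
    exact integral_map hf.measurable.aemeasurable hm.aestronglyMeasurable
  have hnn : 0 ≤ᵐ[μ] fun x => h x - h (f x) := by
    filter_upwards [hle] with x hx using sub_nonneg.2 hx
  filter_upwards [(integral_eq_zero_iff_of_nonneg_ae hnn (hi.sub hi')).1 h0] with x hx
  exact (sub_eq_zero.1 hx).symm

/-- The cross-ratio of `0`, the two graphs and `1` would strictly decrease along the doubling map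
wherever the graphs differ. -/
theorem ae_lowerGraph_eq_upperGraph {a b : Param} (H₀ : FiberStable a b 0)
    (H₁ : FiberStable a b 1) : ∀ᵐ x, lowerGraph a b x = upperGraph a b x := by
  have hm : Measurable fun x => crossRatio (lowerGraph a b x) (upperGraph a b x) := by
    have h1 : Measurable fun x => (lowerGraph a b x : ℝ) :=
      measurable_subtype_coe.comp (measurable_lowerGraph a b)
    have h2 : Measurable fun x => (upperGraph a b x : ℝ) :=
      measurable_subtype_coe.comp (measurable_upperGraph a b)
    exact (h1.mul (measurable_const.sub h2)).div (h2.mul (measurable_const.sub h1))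
  have hlt : ∀ᵐ x, lowerGraph a b x ≠ upperGraph a b x →
      crossRatio (lowerGraph a b (doubling x)) (upperGraph a b (doubling x)) <
        crossRatio (lowerGraph a b x) (upperGraph a b x) := by
    filter_upwards [ae_lowerGraph_pos H₀, ae_upperGraph_lt_one H₁] with x h0 h1 hne
    rw [← fiberMap_lowerGraph, ← fiberMap_upperGraph, coe_fiberMap, coe_fiberMap]
    exact crossRatio_quadratic_lt (abs_byHalf_le a b x) (byHalf_ne_zero a b x) h0
      (Subtype.coe_lt_coe.2 (lt_of_le_of_ne (lowerGraph_le_upperGraph a b x) hne)) h1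
  have hle : ∀ᵐ x, crossRatio (lowerGraph a b (doubling x)) (upperGraph a b (doubling x)) ≤
      crossRatio (lowerGraph a b x) (upperGraph a b x) := by
    filter_upwards [hlt, ae_lowerGraph_pos H₀, ae_upperGraph_lt_one H₁] with x hx h0 h1
    by_cases hne : lowerGraph a b x = upperGraph a b x
    · have h0' : (0 : ℝ) < lowerGraph a b x := h0
      have h1' : (upperGraph a b x : ℝ) < 1 := h1
      have e : crossRatio (lowerGraph a b x) (upperGraph a b x) = 1 := by
        rw [← hne] at h1' ⊢
        exact div_self (mul_pos h0' (sub_pos.2 h1')).ne'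
      rw [e]
      exact crossRatio_le_one (lowerGraph_le_upperGraph a b _)
    · exact (hx hne).le
  have hbound : ∀ x, |crossRatio (lowerGraph a b x) (upperGraph a b x)| ≤ 1 := fun x => by
    rw [abs_of_nonneg crossRatio_nonneg]
    exact crossRatio_le_one (lowerGraph_le_upperGraph a b x)
  filter_upwards [hlt, ae_comp_eq_of_comp_le measurePreserving_doubling hm hbound hle]
    with x hx heq
  by_contra hne
  exact (hx hne).ne heq

theorem isInvariantGraph_lowerGraph (a b : Param) : IsInvariantGraph a b (lowerGraph a b) :=
  ⟨measurable_lowerGraph a b, fiberMap_lowerGraph a b⟩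

theorem separatesBasins_lowerGraph {a b : Param} (H₀ : FiberStable a b 0)
    (H₁ : FiberStable a b 1) :
    SeparatesBasins (skewMap a b) (invSegment 0) (invSegment 1) (lowerGraph a b) := by
  filter_upwards [ae_lowerGraph_eq_upperGraph H₀ H₁] with x hx y
  refine ⟨fun h => (mem_basin_iff a b 0 _).2 ?_, fun h => (mem_basin_iff a b 1 _).2 ?_⟩
  · obtain ⟨z, hz, hyz⟩ := lt_lowerGraph_iff.1 h
    exact attracted_zero_of_le hyz.le hz
  · rw [hx] at h
    obtain ⟨z, hz, hzy⟩ := upperGraph_lt_iff.1 h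
    exact attracted_one_of_le hzy.le hz

/-! ### The parameter regions -/

theorem fiberStable_zero {a b : Param} (h : (a, b) ∈ Gamma0) : FiberStable a b 0 := by
  refine fiberStable_of_mul_lt_one a b (Or.inl rfl) ?_
  have ha : (0 : ℝ) < a := a.2.1
  have h' : (a : ℝ) / (1 + a) < b := h
  rw [div_lt_iff₀ (by linarith)] at h'
  simp only [Set.Icc.coe_zero]
  nlinarith

theorem fiberStable_one {a b : Param} (h : (a, b) ∈ Gamma1) : FiberStable a b 1 := by
  refine fiberStable_of_mul_lt_one a b (Or.inr rfl) ?_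
  have ha : (a : ℝ) < 1 / 2 := a.2.2
  have h' : (b : ℝ) < a / (1 - a) := h
  rw [lt_div_iff₀ (by linarith)] at h'
  simp only [Set.Icc.coe_one]
  nlinarith

end SkewProduct

theorem mainTheorem1 (a b : Param) :
    ((a, b) ∈ Gamma0 →
      IsChaoticAttractor (skewMap a b) (invSegment 0) ∧
      IsEssentialAttractor volume (skewMap a b) (invSegment 0) ∧
      HasLocallyRiddledBasin volume (skewMap a b) (invSegment 0)) ∧
    ((a, b) ∈ Gamma1 →
      IsChaoticAttractor (skewMap a b) (invSegment 1) ∧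
      IsEssentialAttractor volume (skewMap a b) (invSegment 1) ∧
      HasLocallyRiddledBasin volume (skewMap a b) (invSegment 1)) ∧
    ((a, b) ∈ Gamma →
      (IsChaoticAttractor (skewMap a b) (invSegment 0) ∧
        IsEssentialAttractor volume (skewMap a b) (invSegment 0)) ∧
      (IsChaoticAttractor (skewMap a b) (invSegment 1) ∧
        IsEssentialAttractor volume (skewMap a b) (invSegment 1)) ∧
      AreIntermingled volume (skewMap a b) (invSegment 0) (invSegment 1) ∧
      ∃ φ : unitInterval → unitInterval, IsInvariantGraph a b φ ∧
        SeparatesBasins (skewMap a b) (invSegment 0) (invSegment 1) φ) := by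
  have i₀ : (0 : unitInterval) = 0 ∨ (0 : unitInterval) = 1 := Or.inl rfl
  have i₁ : (1 : unitInterval) = 0 ∨ (1 : unitInterval) = 1 := Or.inr rfl
  refine ⟨fun h => ?_, fun h => ?_, fun h => ?_⟩
  · have H := fiberStable_zero h
    exact ⟨isChaoticAttractor_invSegment i₀ H, isEssentialAttractor_invSegment i₀ H,
      hasLocallyRiddledBasin_invSegment i₀ H⟩
  · have H := fiberStable_one h
    exact ⟨isChaoticAttractor_invSegment i₁ H, isEssentialAttractor_invSegment i₁ H,
      hasLocallyRiddledBasin_invSegment i₁ H⟩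
  · have H₀ := fiberStable_zero h.1
    have H₁ := fiberStable_one h.2
    exact ⟨⟨isChaoticAttractor_invSegment i₀ H₀, isEssentialAttractor_invSegment i₀ H₀⟩,
      ⟨isChaoticAttractor_invSegment i₁ H₁, isEssentialAttractor_invSegment i₁ H₁⟩,
      ⟨isRiddledWith_invSegment i₀ i₁ zero_ne_one H₀ H₁,
        isRiddledWith_invSegment i₁ i₀ one_ne_zero H₁ H₀⟩,
      lowerGraph a b, isInvariantGraph_lowerGraph a b, separatesBasins_lowerGraph H₀ H₁⟩
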